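/- **Operator systems.** A unital operator system $(E,e)$ is a complex $*$-vector space with proper cones $M_n(E)_+$ of self-adjoint matrices such that $\alpha^*M_n(E)_+\alpha\subseteq M_m(E)_+$ for all $\alpha\in M_{n,m}(\mathbb C)$, and with an Archimedean matrix order unit $e$; put $e_n=\mathrm{diag}(e,\dots,e)\in M_n(E)$. A unital $C^*$-algebra $A$ is a unital operator system with $e=1$ and $M_n(A)_+$ the positive elements of the $C^*$-algebra $M_n(A)$. A unital completely positive (ucp) map $\varphi:E\to B(\mathcal H)$, with $\mathcal H$ a Hilbert space, is *maximal* if every ucp dilation of $\varphi$ on a Hilbert space containing $\mathcal H$ is obtained by attaching a direct summand; a non-zero completely positive map $\varphi$ is *pure* if all completely positive $\psi$ with $\varphi-\psi$ completely positive are scalar multiples of $\varphi$. **Hermitian forms.** A self-adjoint $x\in M_n(E)$ is a *hermitian form* if there is $g>0$ with $|\varphi^{(n)}(x)|\ge g\cdot \mathrm{id}_{\mathcal H}^{\oplus n}$ for all pure and maximal ucp maps $\varphi:E\to B(\mathcal H)$. Let $H(E,n)$ be the space of hermitian forms in $M_n(E)$, with the topology of the order norm (for self-adjoint $x$: $\|x\|\le\varepsilon$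 iff $-\varepsilon e_n\le x\le\varepsilon e_n$). Call $x\in H(E,n)$ and $x'\in H(E,n')$ equivalent if for some $k\ge n,n'$ the elements $x\oplus e_{k-n}$ and $x'\oplus e_{k-n'}$ lie in the same path component of $H(E,k)$. The set $\mathcal V(E)$ of equivalence classes $[x]$ is a commutative monoid under $[x]+[x']=[x\oplus x']$, with neutral element $0=[e]$, and $K_0(E)$ is its Grothendieck group. **$C^*$-algebraic K-theory.** For a unital $C^*$-algebra $A$, let $\mathcal P(A)$ be the commutative monoid, under direct sum, of homotopy classes of projections in $M_\infty(A)=\bigcup_n M_n(A)$: projections $p\in M_n(A)$ and $q\in M_m(A)$ are equivalent if $p\oplus 0_{k-n}$ and $q\oplus 0_{k-m}$ are joined by a norm-continuous path of projections in $M_k(A)$ for some $k\ge n,m$. The $C^*$-algebraic K-theory group of $A$ is the Grothendieck group of $\mathcal P(A)$. **Proposition.** Let $A$ be a unital $C^*$-algebra. For every $n$ and every hermitian form $x\in H(A,n)$ the element $|x|\in M_n(A)$ is invertible and $\tfrac12(1-x|x|^{-1})$ is a projection, and $$\Phi:\mathcal V(A)\to\mathcal P(A),\qquad [x]\mapsto\big[\tfrac12(1-x|x|^{-1})\big]$$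 is a well-defined isomorphism of monoids. There is an isomorphism of groups from $K_0(A)$, the K-theory group of $A$ as an operator system, onto the $C^*$-algebraic K-theory group of $A$ which maps the class of each $v\in\mathcal V(A)$ to the class of $\Phi(v)$. -/

import Mathlib

universe u

/-! ## Stable homotopy classes of a graded family of spaces with a direct sum -/

/-- A family of spaces `X n` indexed by the matrix size `n`, with a direct sum and distinguished
points `base n` by which one stabilizes.  It only serves to treat at the same time the hermitian
forms (stabilized by units) and the projections (stabilized by zeros); both are constructed
below. -/
structure SumSystem (X : ℕ → Type u) [∀ n, TopologicalSpace (X n)] where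
  dsum : ∀ {n m : ℕ}, X n → X m → X (n + m)
  base : ∀ n : ℕ, X n
  base_dsum : ∀ n m : ℕ, dsum (base n) (base m) = base (n + m)
  joined_dsum : ∀ {n m : ℕ} {x x' : X n} {y y' : X m},
    Joined x x' → Joined y y' → Joined (dsum x y) (dsum x' y')
  dsum_assoc : ∀ {n m k : ℕ} (x : X n) (y : X m) (z : X k),
    (⟨n + m + k, dsum (dsum x y) z⟩ : Σ n, X n) = ⟨n + (m + k), dsum x (dsum y z)⟩
  dsum_base_zero : ∀ {n : ℕ} (x : X n), (⟨n + 0, dsum x (base 0)⟩ : Σ n, X n) = ⟨n, x⟩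
  dsum_comm : ∀ {n m : ℕ} (x : X n) (y : X m), ∃ (k : ℕ) (a b : X k),
    (⟨n + m, dsum x y⟩ : Σ n, X n) = ⟨k, a⟩ ∧ (⟨m + n, dsum y x⟩ : Σ n, X n) = ⟨k, b⟩ ∧
      Joined a b

namespace SumSystem

variable {X : ℕ → Type u} [∀ n, TopologicalSpace (X n)] (S : SumSystem X)

/-- Two elements have the same size `k` and are joined by a path in `X k`. -/
def Homotopic (a b : Σ n, X n) : Prop :=
  ∃ (k : ℕ) (x y : X k), a = ⟨k, x⟩ ∧ b = ⟨k, y⟩ ∧ Joined x y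

/-- The direct sum, on elements of arbitrary sizes. -/
def sum (a b : Σ n, X n) : Σ n, X n := ⟨a.1 + b.1, S.dsum a.2 b.2⟩

/-- The distinguished point of size `n`. -/
def pt (n : ℕ) : Σ n, X n := ⟨n, S.base n⟩

/-- `x ∈ X n` and `x' ∈ X n'` are stably equivalent if `x ⊕ base (k - n)` and
`x' ⊕ base (k - n')` are joined by a path in `X k` for some `k ≥ n, n'`. -/
def StablyEquiv (a b : Σ n, X n) : Prop :=
  ∃ d d' : ℕ, Homotopic (S.sum a (S.pt d)) (S.sum b (S.pt d'))

theorem Homotopic.refl (a : Σ n, X n) : Homotopic a a :=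
  ⟨a.1, a.2, a.2, rfl, rfl, Joined.refl _⟩

theorem Homotopic.symm {a b : Σ n, X n} (h : Homotopic a b) : Homotopic b a := by
  obtain ⟨k, x, y, hx, hy, hxy⟩ := h
  exact ⟨k, y, x, hy, hx, hxy.symm⟩

theorem Homotopic.trans {a b c : Σ n, X n} (h : Homotopic a b) (h' : Homotopic b c) :
    Homotopic a c := by
  obtain ⟨k, x, y, rfl, rfl, hxy⟩ := h
  obtain ⟨l, y', z, hy, rfl, hyz⟩ := h'
  cases hy
  exact ⟨k, x, z, rfl, rfl, hxy.trans hyz⟩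

theorem Homotopic.sum {a a' b b' : Σ n, X n} (h : Homotopic a a') (h' : Homotopic b b') :
    Homotopic (S.sum a b) (S.sum a' b') := by
  obtain ⟨k, x, y, rfl, rfl, hxy⟩ := h
  obtain ⟨l, z, w, rfl, rfl, hzw⟩ := h'
  exact ⟨k + l, S.dsum x z, S.dsum y w, rfl, rfl, S.joined_dsum hxy hzw⟩

theorem sum_assoc (a b c : Σ n, X n) : S.sum (S.sum a b) c = S.sum a (S.sum b c) :=
  S.dsum_assoc a.2 b.2 c.2

theorem sum_pt_zero (a : Σ n, X n) : S.sum a (S.pt 0) = a := S.dsum_base_zero a.2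

theorem sum_comm (a b : Σ n, X n) : Homotopic (S.sum a b) (S.sum b a) := S.dsum_comm a.2 b.2

theorem pt_sum (n m : ℕ) : S.sum (S.pt n) (S.pt m) = S.pt (n + m) := by
  simp [sum, pt, S.base_dsum]

theorem sum_sum_pt (a b : Σ n, X n) (d e : ℕ) :
    Homotopic (S.sum (S.sum a b) (S.pt (d + e)))
      (S.sum (S.sum a (S.pt d)) (S.sum b (S.pt e))) := by
  rw [← S.pt_sum, S.sum_assoc, S.sum_assoc]
  refine Homotopic.sum S (.refl _) ?_
  rw [← S.sum_assoc, ← S.sum_assoc]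
  exact Homotopic.sum S (S.sum_comm _ _) (.refl _)

theorem stablyEquiv_of_homotopic {a b : Σ n, X n} (h : Homotopic a b) : S.StablyEquiv a b :=
  ⟨0, 0, by rwa [S.sum_pt_zero, S.sum_pt_zero]⟩

/-- Stable equivalence as an equivalence relation. -/
def stableSetoid : Setoid (Σ n, X n) where
  r := S.StablyEquiv
  iseqv :=
    { refl := fun _ => S.stablyEquiv_of_homotopic (.refl _)
      symm := fun ⟨d, d', h⟩ => ⟨d', d, h.symm⟩
      trans := by
        rintro a b c ⟨d₁, d₂, h⟩ ⟨d₃, d₄, h'⟩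
        refine ⟨d₁ + d₃, d₄ + d₂, ?_⟩
        rw [← S.pt_sum, ← S.pt_sum, ← S.sum_assoc, ← S.sum_assoc]
        refine (Homotopic.sum S h (.refl _)).trans (.trans ?_ (Homotopic.sum S h' (.refl _)))
        rw [S.sum_assoc, S.sum_assoc, S.pt_sum, S.pt_sum, Nat.add_comm]
        exact .refl _ }

/-- The set of stable homotopy classes: the direct limit of the sets `π₀ (X n)` along
`[x] ↦ [x ⊕ base (m - n)]`. -/
def Classes : Type u := Quotient S.stableSetoid

/-- The class of an element of `X n`. -/
def classOf {n : ℕ} (x : X n) : S.Classes := Quotient.mk S.stableSetoid ⟨n, x⟩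

instance instAddClasses : Add S.Classes where
  add := Quotient.map₂ S.sum (by
    rintro a a' ⟨d, d', h⟩ b b' ⟨e, e', h'⟩
    exact ⟨d + e, d' + e', (S.sum_sum_pt _ _ _ _).trans
      ((Homotopic.sum S h h').trans (S.sum_sum_pt _ _ _ _).symm)⟩)

instance instZeroClasses : Zero S.Classes where
  zero := S.classOf (S.base 0)

/-- The direct sum makes the stable homotopy classes a commutative monoid. -/
instance instAddCommMonoidClasses : AddCommMonoid S.Classes where
  nsmul := nsmulRec
  add_assoc := by
    rintro ⟨a⟩ ⟨b⟩ ⟨c⟩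
    exact congrArg (Quotient.mk S.stableSetoid) (S.sum_assoc a b c)
  zero_add := by
    rintro ⟨a⟩
    refine Quotient.sound (S.stablyEquiv_of_homotopic ((S.sum_comm (S.pt 0) a).trans ?_))
    rw [S.sum_pt_zero]
    exact .refl _
  add_zero := by
    rintro ⟨a⟩
    exact congrArg (Quotient.mk S.stableSetoid) (S.sum_pt_zero a)
  add_comm := by
    rintro ⟨a⟩ ⟨b⟩
    exact Quotient.sound (S.stablyEquiv_of_homotopic (S.sum_comm a b))

end SumSystem

/-! ## Matrices -/

section Matrices

variable {E : Type u}

/-- The direct sum `x ⊕ y = diag(x, y)` of two square matrices. -/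
def matrixSum [Zero E] {n m : ℕ} (x : Matrix (Fin n) (Fin n) E) (y : Matrix (Fin m) (Fin m) E) :
    Matrix (Fin (n + m)) (Fin (n + m)) E :=
  (Matrix.fromBlocks x 0 0 y).reindex finSumFinEquiv finSumFinEquiv

/-- The matrix `α* x α ∈ M_m(E)`, for a scalar matrix `α ∈ M_{n,m}(ℂ)` and `x ∈ M_n(E)`. -/
def compress [AddCommGroup E] [Module ℂ E] {n m : ℕ} (α : Matrix (Fin n) (Fin m) ℂ)
    (x : Matrix (Fin n) (Fin n) E) : Matrix (Fin m) (Fin m) E :=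
  Matrix.of fun i j => ∑ k, ∑ l, (star (α k i) * α l j) • x k l

section entries

variable [Zero E] {n m : ℕ} (x : Matrix (Fin n) (Fin n) E) (y : Matrix (Fin m) (Fin m) E)

theorem matrixSum_castAdd_castAdd (i j : Fin n) :
    matrixSum x y (Fin.castAdd m i) (Fin.castAdd m j) = x i j := by
  simp [matrixSum]

theorem matrixSum_castAdd_natAdd (i : Fin n) (j : Fin m) :
    matrixSum x y (Fin.castAdd m i) (Fin.natAdd n j) = 0 := by
  simp [matrixSum]

theorem matrixSum_natAdd_castAdd (i : Fin m) (j : Fin n) :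
    matrixSum x y (Fin.natAdd n i) (Fin.castAdd m j) = 0 := by
  simp [matrixSum]

theorem matrixSum_natAdd_natAdd (i j : Fin m) :
    matrixSum x y (Fin.natAdd n i) (Fin.natAdd n j) = y i j := by
  simp [matrixSum]

end entries

/-- Two matrices on `Fin (n + m)` agree if they agree on the four blocks. -/
theorem matrix_ext_blocks {n m : ℕ} {a b : Matrix (Fin (n + m)) (Fin (n + m)) E}
    (h₁ : ∀ i j, a (Fin.castAdd m i) (Fin.castAdd m j) = b (Fin.castAdd m i) (Fin.castAdd m j))
    (h₂ : ∀ i j, a (Fin.castAdd m i) (Fin.natAdd n j) = b (Fin.castAdd m i) (Fin.natAdd n j))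
    (h₃ : ∀ i j, a (Fin.natAdd n i) (Fin.castAdd m j) = b (Fin.natAdd n i) (Fin.castAdd m j))
    (h₄ : ∀ i j, a (Fin.natAdd n i) (Fin.natAdd n j) = b (Fin.natAdd n i) (Fin.natAdd n j)) :
    a = b := by
  ext i j
  refine Fin.addCases (fun i => ?_) (fun i => ?_) i <;>
    refine Fin.addCases (fun j => ?_) (fun j => ?_) j
  · exact h₁ i j
  · exact h₂ i j
  · exact h₃ i j
  · exact h₄ i j

theorem matrixSum_assoc [Zero E] {n m k : ℕ} (x : Matrix (Fin n) (Fin n) E)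
    (y : Matrix (Fin m) (Fin m) E) (z : Matrix (Fin k) (Fin k) E) :
    matrixSum (matrixSum x y) z =
      (matrixSum x (matrixSum y z)).submatrix (Fin.cast (Nat.add_assoc n m k))
        (Fin.cast (Nat.add_assoc n m k)) := by
  have e₁ : ∀ i : Fin n, Fin.cast (Nat.add_assoc n m k) (Fin.castAdd k (Fin.castAdd m i)) =
      Fin.castAdd (m + k) i := fun i => Fin.ext (by simp)
  have e₂ : ∀ i : Fin m, Fin.cast (Nat.add_assoc n m k) (Fin.castAdd k (Fin.natAdd n i)) =
      Fin.natAdd n (Fin.castAdd k i) := fun i => Fin.ext (by simp)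
  have e₃ : ∀ i : Fin k, Fin.cast (Nat.add_assoc n m k) (Fin.natAdd (n + m) i) =
      Fin.natAdd n (Fin.natAdd m i) := fun i => Fin.ext (by simp [Nat.add_assoc])
  ext i j
  refine Fin.addCases (fun i => Fin.addCases (fun i => ?_) (fun i => ?_) i) (fun i => ?_) i <;>
    refine Fin.addCases (fun j => Fin.addCases (fun j => ?_) (fun j => ?_) j) (fun j => ?_) j <;>
    simp only [Matrix.submatrix_apply, e₁, e₂, e₃, matrixSum_castAdd_castAdd,
      matrixSum_castAdd_natAdd, matrixSum_natAdd_castAdd, matrixSum_natAdd_natAdd]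

theorem matrixSum_comm [Zero E] {n m : ℕ} (x : Matrix (Fin n) (Fin n) E)
    (y : Matrix (Fin m) (Fin m) E) :
    matrixSum y x = (matrixSum x y).submatrix finAddFlip finAddFlip := by
  refine matrix_ext_blocks ?_ ?_ ?_ ?_ <;> intro i j <;>
    simp only [Matrix.submatrix_apply, finAddFlip_apply_castAdd, finAddFlip_apply_natAdd,
      matrixSum_castAdd_castAdd, matrixSum_castAdd_natAdd, matrixSum_natAdd_castAdd,
      matrixSum_natAdd_natAdd]

theorem matrixSum_map [Zero E] {F : Type*} [Zero F] (f : E → F) (hf : f 0 = 0) {n m : ℕ}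
    (x : Matrix (Fin n) (Fin n) E) (y : Matrix (Fin m) (Fin m) E) :
    (matrixSum x y).map f = matrixSum (x.map f) (y.map f) := by
  refine matrix_ext_blocks ?_ ?_ ?_ ?_ <;> intro i j <;>
    simp only [Matrix.map_apply, matrixSum_castAdd_castAdd, matrixSum_castAdd_natAdd,
      matrixSum_natAdd_castAdd, matrixSum_natAdd_natAdd, hf]

theorem matrixSum_add [AddCommGroup E] {n m : ℕ} (x x' : Matrix (Fin n) (Fin n) E)
    (y y' : Matrix (Fin m) (Fin m) E) :
    matrixSum (x + x') (y + y') = matrixSum x y + matrixSum x' y' := by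
  refine matrix_ext_blocks ?_ ?_ ?_ ?_ <;> intro i j <;>
    simp only [Matrix.add_apply, matrixSum_castAdd_castAdd, matrixSum_castAdd_natAdd,
      matrixSum_natAdd_castAdd, matrixSum_natAdd_natAdd, add_zero]

theorem matrixSum_sub [AddCommGroup E] {n m : ℕ} (x x' : Matrix (Fin n) (Fin n) E)
    (y y' : Matrix (Fin m) (Fin m) E) :
    matrixSum (x - x') (y - y') = matrixSum x y - matrixSum x' y' := by
  refine matrix_ext_blocks ?_ ?_ ?_ ?_ <;> intro i j <;>
    simp only [Matrix.sub_apply, matrixSum_castAdd_castAdd, matrixSum_castAdd_natAdd,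
      matrixSum_natAdd_castAdd, matrixSum_natAdd_natAdd, sub_zero]

theorem matrixSum_smul [AddCommGroup E] [Module ℂ E] (c : ℂ) {n m : ℕ}
    (x : Matrix (Fin n) (Fin n) E) (y : Matrix (Fin m) (Fin m) E) :
    matrixSum (c • x) (c • y) = c • matrixSum x y := by
  refine matrix_ext_blocks ?_ ?_ ?_ ?_ <;> intro i j <;>
    simp only [Matrix.smul_apply, matrixSum_castAdd_castAdd, matrixSum_castAdd_natAdd,
      matrixSum_natAdd_castAdd, matrixSum_natAdd_natAdd, smul_zero]

theorem matrixSum_conjTranspose [AddCommGroup E] [StarAddMonoid E] {n m : ℕ}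
    (x : Matrix (Fin n) (Fin n) E) (y : Matrix (Fin m) (Fin m) E) :
    (matrixSum x y).conjTranspose = matrixSum x.conjTranspose y.conjTranspose := by
  refine matrix_ext_blocks ?_ ?_ ?_ ?_ <;> intro i j <;>
    simp only [Matrix.conjTranspose_apply, matrixSum_castAdd_castAdd, matrixSum_castAdd_natAdd,
      matrixSum_natAdd_castAdd, matrixSum_natAdd_natAdd, star_zero]

theorem matrixSum_mul {R : Type u} [NonUnitalNonAssocSemiring R] {n m : ℕ}
    (x x' : Matrix (Fin n) (Fin n) R) (y y' : Matrix (Fin m) (Fin m) R) :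
    matrixSum (x * x') (y * y') = matrixSum x y * matrixSum x' y' := by
  refine matrix_ext_blocks ?_ ?_ ?_ ?_ <;> intro i j <;>
    simp [Matrix.mul_apply, Fin.sum_univ_add, matrixSum_castAdd_castAdd,
      matrixSum_castAdd_natAdd, matrixSum_natAdd_castAdd, matrixSum_natAdd_natAdd]

theorem matrixSum_diagonal [Zero E] (e : E) (n m : ℕ) :
    matrixSum (Matrix.diagonal fun _ : Fin n => e) (Matrix.diagonal fun _ : Fin m => e) =
      Matrix.diagonal fun _ => e := by
  refine matrix_ext_blocks ?_ ?_ ?_ ?_ <;> intro i j <;>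
    simp only [matrixSum_castAdd_castAdd, matrixSum_castAdd_natAdd, matrixSum_natAdd_castAdd,
      matrixSum_natAdd_natAdd, Matrix.diagonal_apply, Fin.ext_iff, Fin.val_castAdd,
      Fin.val_natAdd, Nat.add_left_cancel_iff]
  · rw [if_neg]; have := i.2; omega
  · rw [if_neg]; have := j.2; omega

/-- A permutation matrix acts by permuting rows and columns. -/
theorem compress_permMatrix [AddCommGroup E] [Module ℂ E] {n : ℕ} (σ : Equiv.Perm (Fin n))
    (x : Matrix (Fin n) (Fin n) E) :
    compress ((σ⁻¹).permMatrix ℂ) x = x.submatrix σ σ := by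
  ext i j
  simp only [compress, Matrix.of_apply, Matrix.submatrix_apply, Equiv.Perm.permMatrix,
    PEquiv.toMatrix_apply, Equiv.toPEquiv_apply, Option.mem_def, Option.some.injEq]
  rw [Finset.sum_eq_single (σ i)]
  · rw [Finset.sum_eq_single (σ j)]
    · simp
    · intro b _ hb
      have : ¬ (Equiv.symm σ b = j) := fun h => hb (by rw [← h]; simp)
      simp [this]
    · simp
  · intro b _ hb
    have : ¬ (Equiv.symm σ b = i) := fun h => hb (by rw [← h]; simp)
    simp [this]
  · simp

theorem compress_eq_mul {A : Type u} [CStarAlgebra A] {n m : ℕ} (α : Matrix (Fin n) (Fin m) ℂ) (x : Matrix (Fin n) (Fin n) A) :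
    compress α x = (α.map (algebraMap ℂ A)).conjTranspose * (x * α.map (algebraMap ℂ A)) := by
  ext i j
  simp only [compress, Matrix.of_apply, Matrix.mul_apply, Matrix.conjTranspose_apply,
    Matrix.map_apply, Finset.mul_sum]
  refine Finset.sum_congr rfl fun k _ => Finset.sum_congr rfl fun l _ => ?_
  rw [← algebraMap_star_comm, ← Algebra.commutes, ← Algebra.smul_def, ← Algebra.smul_def,
    smul_smul]

theorem compress_isHermitian {E : Type u} [AddCommGroup E] [Module ℂ E] [StarAddMonoid E] [StarModule ℂ E]
    {n m : ℕ} (α : Matrix (Fin n) (Fin m) ℂ)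
    {x : Matrix (Fin n) (Fin n) E} (hx : x.IsHermitian) : (compress α x).IsHermitian := by
  ext i j
  simp only [Matrix.conjTranspose_apply, compress, Matrix.of_apply, star_sum, star_smul,
    star_mul, star_star]
  rw [Finset.sum_comm]
  refine Finset.sum_congr rfl fun k _ => Finset.sum_congr rfl fun l _ => ?_
  rw [hx.apply]

theorem compress_map {E : Type u} [AddCommGroup E] [Module ℂ E]
    {F : Type*} [AddCommGroup F] [Module ℂ F] (φ : E →ₗ[ℂ] F) {n m : ℕ}
    (α : Matrix (Fin n) (Fin m) ℂ) (x : Matrix (Fin n) (Fin n) E) :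
    (compress α x).map φ = compress α (x.map φ) := by
  ext i j
  simp [compress]

theorem isHermitian_sum_unit {E : Type u} [AddCommGroup E] [Module ℂ E] [StarAddMonoid E] [StarModule ℂ E]
    {n : ℕ} (w : Matrix (Fin n) (Fin n) E) :
    ((1 / 2 : ℂ) • (w + w.conjTranspose)).IsHermitian ∧
      ((-Complex.I / 2 : ℂ) • (w - w.conjTranspose)).IsHermitian := by
  constructor
  · rw [Matrix.IsHermitian, Matrix.conjTranspose_smul, Matrix.conjTranspose_add,
      Matrix.conjTranspose_conjTranspose, add_comm]
    simp
  · rw [Matrix.IsHermitian, Matrix.conjTranspose_smul, Matrix.conjTranspose_sub,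
      Matrix.conjTranspose_conjTranspose, ← neg_sub w, smul_neg, ← neg_smul]
    congr 1
    simp [neg_div]

theorem compress_eq_combination {E : Type u} [AddCommGroup E] [Module ℂ E]
    {n : ℕ} (u : Matrix (Fin n) (Fin n) ℂ)
    (x : Matrix (Fin n) (Fin n) E) :
    compress u x = ∑ p : (Fin n × Fin n) × (Fin n × Fin n),
      (star (u p.2.1 p.1.1) * u p.2.2 p.1.2) •
        Matrix.single p.1.1 p.1.2 (x p.2.1 p.2.2) := by
  ext i j
  rw [Matrix.sum_apply, Fintype.sum_prod_type, Finset.sum_eq_single (i, j)]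
  · simp [compress, Fintype.sum_prod_type]
  · rintro ⟨k, l⟩ _ hkl
    refine Finset.sum_eq_zero fun p _ => ?_
    rw [Matrix.smul_apply, Matrix.single_apply_of_ne, smul_zero]
    rintro ⟨rfl, rfl⟩
    exact hkl rfl
  · simp

theorem continuous_matrixSum {A : Type u} [CStarAlgebra A]
    {n m : ℕ} :
    Continuous fun z : Matrix (Fin n) (Fin n) A × Matrix (Fin m) (Fin m) A =>
      matrixSum z.1 z.2 :=
  (Continuous.matrix_fromBlocks continuous_fst continuous_const continuous_const
    continuous_snd).matrix_reindex _ _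

/-- A path of unitary scalar matrices from the identity to a self-adjoint unitary one. -/
noncomputable def unitaryPath {n : ℕ} (s : Matrix (Fin n) (Fin n) ℂ) (t : ℝ) :
    Matrix (Fin n) (Fin n) ℂ :=
  ((1 / 2 : ℂ) • (1 + s)) + Complex.exp (Real.pi * t * Complex.I) • ((1 / 2 : ℂ) • (1 - s))

theorem unitaryPath_zero {n : ℕ} (s : Matrix (Fin n) (Fin n) ℂ) : unitaryPath s 0 = 1 := by
  simp only [unitaryPath, Complex.ofReal_zero, mul_zero, zero_mul, Complex.exp_zero, one_smul,
    ← smul_add]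
  rw [show (1 + s + (1 - s) : Matrix (Fin n) (Fin n) ℂ) = (2 : ℂ) • 1 by
    rw [two_smul]; abel, smul_smul]
  norm_num

theorem unitaryPath_one {n : ℕ} (s : Matrix (Fin n) (Fin n) ℂ) : unitaryPath s 1 = s := by
  simp only [unitaryPath, Complex.ofReal_one, mul_one, Complex.exp_pi_mul_I, neg_smul, one_smul,
    ← sub_eq_add_neg, ← smul_sub]
  rw [show (1 + s - (1 - s) : Matrix (Fin n) (Fin n) ℂ) = (2 : ℂ) • s by
    rw [two_smul]; abel, smul_smul]
  norm_num

theorem unitaryPath_star_mul {n : ℕ} {s : Matrix (Fin n) (Fin n) ℂ} (hs : star s = s)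
    (hs' : s * s = 1) (t : ℝ) : star (unitaryPath s t) * unitaryPath s t = 1 := by
  have hz : star (Complex.exp (Real.pi * t * Complex.I)) *
      Complex.exp (Real.pi * t * Complex.I) = 1 := by
    rw [Complex.star_def, ← Complex.exp_conj, ← Complex.exp_add]
    simp
  unfold unitaryPath
  generalize Complex.exp (Real.pi * t * Complex.I) = z at hz ⊢
  have h2 : star (1 / 2 : ℂ) = 1 / 2 := by simp
  simp only [star_add, star_smul, star_sub, star_one, hs, h2]
  have e₁ : (1 + s) * (1 + s) = (2 : ℂ) • (1 + s) := by
    rw [two_smul, add_mul, mul_add, mul_add, hs']; simp; abel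
  have e₂ : (1 - s) * (1 - s) = (2 : ℂ) • (1 - s) := by
    rw [two_smul, sub_mul, mul_sub, mul_sub, hs']; simp; abel
  have e₃ : (1 + s) * (1 - s) = 0 := by
    rw [add_mul, mul_sub, mul_sub, hs']; simp
  have e₄ : (1 - s) * (1 + s) = 0 := by
    rw [sub_mul, mul_add, mul_add, hs']; simp [add_comm]
  have e₅ : 1 + s + (1 - s) = (2 : ℂ) • (1 : Matrix (Fin n) (Fin n) ℂ) := by
    rw [two_smul]; abel
  generalize 1 + s = p at e₁ e₃ e₄ e₅ ⊢
  generalize 1 - s = q at e₂ e₃ e₄ e₅ ⊢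
  simp only [add_mul, mul_add, smul_mul_assoc, mul_smul_comm, e₁, e₂, e₃, e₄, smul_zero,
    add_zero, zero_add, smul_smul]
  have hz' : z * star z = 1 := by rw [mul_comm]; exact hz
  trans (1 / 2 : ℂ) • (p + q)
  · rw [smul_add]
    congr 2
    · norm_num
    · linear_combination (1 / 2 : ℂ) * hz'
  · rw [e₅, smul_smul]; norm_num

theorem continuous_unitaryPath {n : ℕ} (s : Matrix (Fin n) (Fin n) ℂ) (i j : Fin n) :
    Continuous fun t => unitaryPath s t i j := by
  simp only [unitaryPath, Matrix.add_apply, Matrix.smul_apply]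
  fun_prop

theorem star_permMatrix_swap {n : ℕ} (a b : Fin n) :
    star ((Equiv.swap a b)⁻¹.permMatrix ℂ) = (Equiv.swap a b)⁻¹.permMatrix ℂ := by
  rw [Matrix.star_eq_conjTranspose, Matrix.conjTranspose_permMatrix]
  simp

theorem permMatrix_swap_mul_self {n : ℕ} (a b : Fin n) :
    (Equiv.swap a b)⁻¹.permMatrix ℂ * (Equiv.swap a b)⁻¹.permMatrix ℂ = 1 := by
  rw [← Matrix.permMatrix_mul]
  simp

end Matrices

/-! ## Operator systems -/

/-- A unital operator system: a matrix-ordered `*`-vector space `E` (proper cones `M_n(E)₊` of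
self-adjoint matrices with `α* M_n(E)₊ α ⊆ M_m(E)₊` for all scalar `n × m` matrices `α`) with an
Archimedean matrix order unit `e`; the order unit of `M_n(E)` is `e_n = diag(e, …, e)`. -/
class UnitalOperatorSystem (E : Type u) [AddCommGroup E] [Module ℂ E] [StarAddMonoid E]
    [StarModule ℂ E] where
  e : E
  cone : ∀ n : ℕ, Set (Matrix (Fin n) (Fin n) E)
  isHermitian_of_mem : ∀ {n : ℕ} {x : Matrix (Fin n) (Fin n) E}, x ∈ cone n → x.IsHermitian
  add_mem : ∀ {n : ℕ} {x y : Matrix (Fin n) (Fin n) E},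
    x ∈ cone n → y ∈ cone n → x + y ∈ cone n
  smul_mem : ∀ {n : ℕ} {x : Matrix (Fin n) (Fin n) E} {r : ℝ}, 0 ≤ r → x ∈ cone n →
    (r : ℂ) • x ∈ cone n
  compress_mem : ∀ {n m : ℕ} (α : Matrix (Fin n) (Fin m) ℂ) {x : Matrix (Fin n) (Fin n) E},
    x ∈ cone n → compress α x ∈ cone m
  eq_zero_of_mem : ∀ {n : ℕ} {x : Matrix (Fin n) (Fin n) E}, x ∈ cone n → -x ∈ cone n → x = 0
  orderUnit : ∀ {n : ℕ} {x : Matrix (Fin n) (Fin n) E}, x.IsHermitian →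
    ∃ r : ℝ, 0 < r ∧ (r : ℂ) • Matrix.diagonal (fun _ : Fin n => e) + x ∈ cone n
  archimedean : ∀ {n : ℕ} {x : Matrix (Fin n) (Fin n) E}, x.IsHermitian →
    (∀ r : ℝ, 0 < r → (r : ℂ) • Matrix.diagonal (fun _ : Fin n => e) + x ∈ cone n) → x ∈ cone n

/-! ## The C*-algebra of matrices over a C*-algebra -/

/-- The C*-algebra `M_n(A)`. -/
def MatAlg (n : ℕ) (A : Type u) : Type u := CStarMatrix (Fin n) (Fin n) A

section CStarMatrices

variable {A : Type u} [CStarAlgebra A] [PartialOrder A] [StarOrderedRing A]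

noncomputable instance MatAlg.instCStarAlgebra (n : ℕ) : CStarAlgebra (MatAlg n A) :=
  inferInstanceAs (CStarAlgebra (CStarMatrix (Fin n) (Fin n) A))

noncomputable instance MatAlg.instPartialOrder (n : ℕ) : PartialOrder (MatAlg n A) :=
  CStarAlgebra.spectralOrder _

instance MatAlg.instStarOrderedRing (n : ℕ) : StarOrderedRing (MatAlg n A) :=
  CStarAlgebra.spectralOrderedRing _

/-- The identity map, from matrices over `A` to the C*-algebra `M_n(A)`. -/
noncomputable def toMatAlg {n : ℕ} : Matrix (Fin n) (Fin n) A ≃⋆ₐ[ℂ] MatAlg n A where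
  toFun x := x
  invFun x := x
  left_inv _ := rfl
  right_inv _ := rfl
  map_mul' _ _ := rfl
  map_add' _ _ := rfl
  map_star' _ := rfl
  map_smul' _ _ := rfl

theorem continuous_toMatAlg {n : ℕ} :
    Continuous (toMatAlg : Matrix (Fin n) (Fin n) A → MatAlg n A) :=
  continuous_id (X := Matrix (Fin n) (Fin n) A)

theorem continuous_toMatAlg_symm {n : ℕ} :
    Continuous (toMatAlg.symm : MatAlg n A → Matrix (Fin n) (Fin n) A) :=
  continuous_id (X := Matrix (Fin n) (Fin n) A)

theorem toMatAlg_star_mul_self_nonneg {n m : ℕ} (B : Matrix (Fin n) (Fin m) A) :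
    0 ≤ toMatAlg (B.conjTranspose * B) := by
  rcases Nat.eq_zero_or_pos m with rfl | hm
  · rw [Subsingleton.elim (B.conjTranspose * B) 0, map_zero]
  · let R : Fin n → Matrix (Fin m) (Fin m) A := fun k =>
      Matrix.of fun i j => if i = ⟨0, hm⟩ then B k j else 0
    have : B.conjTranspose * B = ∑ k, star (R k) * R k := by
      ext i j
      rw [Matrix.sum_apply, Matrix.mul_apply]
      refine Finset.sum_congr rfl fun k _ => ?_
      rw [Matrix.mul_apply, Finset.sum_eq_single ⟨0, hm⟩]
      · simp [R, Matrix.star_apply]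
      · intro b _ hb
        simp [R, hb]
      · simp
    rw [this, map_sum]
    refine Finset.sum_nonneg fun k _ => ?_
    rw [map_mul, map_star]
    exact star_mul_self_nonneg _

theorem toMatAlg_compress_nonneg {n m : ℕ} (α : Matrix (Fin n) (Fin m) ℂ)
    {x : Matrix (Fin n) (Fin n) A} (hx : 0 ≤ toMatAlg x) : 0 ≤ toMatAlg (compress α x) := by
  obtain ⟨b, hb⟩ := CStarAlgebra.nonneg_iff_eq_star_mul_self.mp hx
  obtain ⟨B, rfl⟩ : ∃ B, toMatAlg B = b := ⟨toMatAlg.symm b, rfl⟩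
  rw [← map_star, ← map_mul] at hb
  have hB : x = B.conjTranspose * B := toMatAlg.injective hb
  have : compress α x = (B * α.map (algebraMap ℂ A)).conjTranspose *
      (B * α.map (algebraMap ℂ A)) := by
    rw [Matrix.conjTranspose_mul, Matrix.mul_assoc, ← Matrix.mul_assoc _ B, ← hB,
      compress_eq_mul]
  rw [this]
  exact toMatAlg_star_mul_self_nonneg _

theorem toMatAlg_smul_diagonal_one (n : ℕ) (r : ℝ) :
    toMatAlg ((r : ℂ) • Matrix.diagonal fun _ : Fin n => (1 : A)) = algebraMap ℝ _ r := by
  rw [map_smul, Matrix.diagonal_one, map_one, Algebra.algebraMap_eq_smul_one]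
  rfl

/-- A unital C*-algebra is a unital operator system, with `M_n(A)₊` the positive elements of the
C*-algebra `M_n(A)`, and with `e = 1`. -/
noncomputable instance CStarAlgebra.instUnitalOperatorSystem : UnitalOperatorSystem A where
  e := 1
  cone n := {x | 0 ≤ toMatAlg x}
  isHermitian_of_mem {n x} hx := by
    have hx' : 0 ≤ toMatAlg x := hx
    have h := IsSelfAdjoint.of_nonneg hx'
    rw [IsSelfAdjoint, ← map_star] at h
    exact toMatAlg.injective h
  add_mem {n x y} hx hy := by
    rw [Set.mem_ofPred, map_add]
    exact add_nonneg hx hy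
  smul_mem {n x r} hr hx := by
    rw [Set.mem_ofPred, map_smul]
    have h : 0 ≤ r • toMatAlg x := smul_nonneg hr hx
    exact h
  compress_mem α _ hx := toMatAlg_compress_nonneg α hx
  eq_zero_of_mem {n x} hx hx' := by
    rw [Set.mem_ofPred, map_neg] at hx'
    exact toMatAlg.injective ((le_antisymm (neg_nonneg.mp hx') hx).trans (map_zero _).symm)
  orderUnit {n x} hx := by
    have hx' : IsSelfAdjoint (toMatAlg x) := by
      rw [IsSelfAdjoint, ← map_star]
      exact congrArg _ hx
    refine ⟨‖toMatAlg x‖ + 1, by positivity, ?_⟩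
    have h := hx'.neg_algebraMap_norm_le_self
    rw [Set.mem_ofPred, map_add, toMatAlg_smul_diagonal_one, map_add, map_one, add_right_comm]
    exact add_nonneg (by rwa [← neg_le_iff_add_nonneg']) zero_le_one
  archimedean {n x} hx h := by
    have hc : IsClosed {a : MatAlg n A | 0 ≤ a} := CStarAlgebra.isClosed_nonneg
    have ht : Filter.Tendsto (fun r : ℝ => algebraMap ℝ (MatAlg n A) r + toMatAlg x)
        (nhdsWithin 0 (Set.Ioi 0)) (nhds (toMatAlg x)) := by
      have : Continuous fun r : ℝ => algebraMap ℝ (MatAlg n A) r + toMatAlg x := by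
        simp only [Algebra.algebraMap_eq_smul_one]
        fun_prop
      have h0 := this.tendsto 0
      rw [map_zero, zero_add] at h0
      exact h0.mono_left nhdsWithin_le_nhds
    refine hc.mem_of_tendsto ht ?_
    filter_upwards [self_mem_nhdsWithin] with r hr
    have := h r hr
    rwa [Set.mem_ofPred, map_add, toMatAlg_smul_diagonal_one] at this

end CStarMatrices

section OperatorSystems

variable {E : Type u} [AddCommGroup E] [Module ℂ E] [StarAddMonoid E] [StarModule ℂ E]
  [UnitalOperatorSystem E]
variable {F : Type u} [AddCommGroup F] [Module ℂ F] [StarAddMonoid F] [StarModule ℂ F]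
  [UnitalOperatorSystem F]

open UnitalOperatorSystem

/-- Completely positive maps: all `φ⁽ⁿ⁾ : M_n(E) → M_n(F)` are positive. -/
def IsCP (φ : E →ₗ[ℂ] F) : Prop :=
  ∀ (n : ℕ) (x : Matrix (Fin n) (Fin n) E), x ∈ cone n → x.map φ ∈ cone n

/-- Unital completely positive maps. -/
def IsUCP (φ : E →ₗ[ℂ] F) : Prop := IsCP φ ∧ φ e = e

/-- A non-zero completely positive map `φ` is pure if the only completely positive maps `ψ` with
`φ - ψ` completely positive are scalar multiples of `φ`. -/
def IsPureCP (φ : E →ₗ[ℂ] F) : Prop :=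
  IsCP φ ∧ φ ≠ 0 ∧ ∀ ψ : E →ₗ[ℂ] F, IsCP ψ → IsCP (φ - ψ) → ∃ c : ℂ, ψ = c • φ

/-- A ucp map `φ : E → B(H)` is maximal if every dilation `ψ : E → B(K)` of `φ` (a ucp map with
`V* ψ(x) V = φ(x)` for an isometric inclusion `V : H → K`) is obtained by attaching a direct
summand, i.e. if every `ψ(x)` is block diagonal for `K = V H ⊕ (V H)ᗮ`. -/
def IsMaximalUCP {H : Type u} [NormedAddCommGroup H] [InnerProductSpace ℂ H] [CompleteSpace H]
    (φ : E →ₗ[ℂ] (H →L[ℂ] H)) : Prop :=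
  IsUCP φ ∧
    ∀ (K : Type u) [NormedAddCommGroup K] [InnerProductSpace ℂ K] [CompleteSpace K]
      (V : H →ₗᵢ[ℂ] K) (ψ : E →ₗ[ℂ] (K →L[ℂ] K)), IsUCP ψ →
      (∀ x : E, (ContinuousLinearMap.adjoint V.toContinuousLinearMap) ∘L ψ x ∘L
        V.toContinuousLinearMap = φ x) →
      ∀ x : E, Commute (V.toContinuousLinearMap ∘L
        ContinuousLinearMap.adjoint V.toContinuousLinearMap) (ψ x)

/-- Hermitian forms: self-adjoint `x ∈ M_n(E)` such that, for some `g > 0`,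
`|φ⁽ⁿ⁾(x)| ≥ g · 1` in `M_n(B(H))` for all pure and maximal ucp maps `φ : E → B(H)`. -/
def IsHermForm {n : ℕ} (x : Matrix (Fin n) (Fin n) E) : Prop :=
  x.IsHermitian ∧ ∃ g : ℝ, 0 < g ∧
    ∀ (H : Type u) [NormedAddCommGroup H] [InnerProductSpace ℂ H] [CompleteSpace H]
      (φ : E →ₗ[ℂ] (H →L[ℂ] H)), IsPureCP φ → IsMaximalUCP φ →
      algebraMap ℝ (MatAlg n (H →L[ℂ] H)) g ≤ CFC.abs (toMatAlg (x.map φ))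

variable (E) in
/-- The space `H(E, n)` of hermitian forms in `M_n(E)`. -/
structure HermForm (n : ℕ) where
  val : Matrix (Fin n) (Fin n) E
  property : IsHermForm val

/-- `‖x‖ ≤ ε` in the order norm, for self-adjoint `x ∈ M_n(E)`: `-ε e_n ≤ x ≤ ε e_n`. -/
def OrderNormLE {n : ℕ} (x : Matrix (Fin n) (Fin n) E) (ε : ℝ) : Prop :=
  (ε : ℂ) • Matrix.diagonal (fun _ : Fin n => (e : E)) + x ∈ cone n ∧
    (ε : ℂ) • Matrix.diagonal (fun _ : Fin n => (e : E)) - x ∈ cone n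

theorem unit_mem (n : ℕ) : Matrix.diagonal (fun _ : Fin n => (e : E)) ∈ cone n := by
  obtain ⟨r, hr, h⟩ := orderUnit (E := E) (n := n) (x := 0) Matrix.isHermitian_zero
  rw [add_zero] at h
  have := smul_mem (r := r⁻¹) (by positivity) h
  rwa [smul_smul, ← Complex.ofReal_mul, inv_mul_cancel₀ hr.ne', Complex.ofReal_one, one_smul]
    at this

theorem OrderNormLE.mono {n : ℕ} {x : Matrix (Fin n) (Fin n) E} {ε δ : ℝ}
    (h : OrderNormLE x ε) (hεδ : ε ≤ δ) : OrderNormLE x δ := by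
  have key := smul_mem (sub_nonneg.mpr hεδ) (unit_mem (E := E) n)
  constructor
  · have := add_mem key h.1
    rw [← add_assoc, ← add_smul] at this
    simpa using this
  · have := add_mem key h.2
    rw [← add_sub_assoc, ← add_smul] at this
    simpa using this

/-- The topology of the order norm on `H(E, n)`. -/
instance HermForm.instTopologicalSpace (n : ℕ) : TopologicalSpace (HermForm E n) where
  IsOpen U := ∀ x ∈ U, ∃ ε : ℝ, 0 < ε ∧ ∀ y : HermForm E n, OrderNormLE (y.val - x.val) ε → y ∈ U
  isOpen_univ _ _ := ⟨1, one_pos, fun _ _ => trivial⟩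
  isOpen_inter U V hU hV x hx := by
    obtain ⟨ε, hε, h⟩ := hU x hx.1
    obtain ⟨δ, hδ, h'⟩ := hV x hx.2
    exact ⟨min ε δ, lt_min hε hδ, fun y hy =>
      ⟨h y (hy.mono (min_le_left _ _)), h' y (hy.mono (min_le_right _ _))⟩⟩
  isOpen_sUnion s hs x := by
    rintro ⟨U, hU, hx⟩
    obtain ⟨ε, hε, h⟩ := hs U hU x hx
    exact ⟨ε, hε, fun y hy => ⟨U, hU, h y hy⟩⟩

end OperatorSystems

section AbsoluteValues

variable {A : Type u} [CStarAlgebra A] [PartialOrder A] [StarOrderedRing A]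

theorem toMatAlg_matrixSum_nonneg {n m : ℕ} {x : Matrix (Fin n) (Fin n) A}
    {y : Matrix (Fin m) (Fin m) A} (hx : 0 ≤ toMatAlg x) (hy : 0 ≤ toMatAlg y) :
    0 ≤ toMatAlg (matrixSum x y) := by
  obtain ⟨a, ha⟩ := CStarAlgebra.nonneg_iff_eq_star_mul_self.mp hx
  obtain ⟨b, hb⟩ := CStarAlgebra.nonneg_iff_eq_star_mul_self.mp hy
  obtain ⟨a, rfl⟩ : ∃ B, toMatAlg B = a := ⟨toMatAlg.symm a, rfl⟩
  obtain ⟨b, rfl⟩ : ∃ B, toMatAlg B = b := ⟨toMatAlg.symm b, rfl⟩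
  rw [← map_star, ← map_mul] at ha hb
  rw [toMatAlg.injective ha, toMatAlg.injective hb, matrixSum_mul, Matrix.star_eq_conjTranspose,
    Matrix.star_eq_conjTranspose, ← matrixSum_conjTranspose]
  exact toMatAlg_star_mul_self_nonneg _

theorem abs_toMatAlg_matrixSum {n m : ℕ} (x : Matrix (Fin n) (Fin n) A)
    (y : Matrix (Fin m) (Fin m) A) :
    CFC.abs (toMatAlg (matrixSum x y)) =
      toMatAlg (matrixSum (toMatAlg.symm (CFC.abs (toMatAlg x)))
        (toMatAlg.symm (CFC.abs (toMatAlg y)))) := by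
  refine CFC.sqrt_unique ?_ (toMatAlg_matrixSum_nonneg (CFC.abs_nonneg (toMatAlg x))
    (CFC.abs_nonneg (toMatAlg y)))
  rw [← map_mul, ← matrixSum_mul, ← map_mul, ← map_mul, CFC.abs_mul_abs, CFC.abs_mul_abs,
    ← map_star, ← map_star, ← map_star, ← map_mul, ← map_mul, ← map_mul]
  rw [Matrix.star_eq_conjTranspose (matrixSum x y), matrixSum_conjTranspose, ← matrixSum_mul]
  rfl

theorem algebraMap_le_abs_matrixSum {n m : ℕ} {x : Matrix (Fin n) (Fin n) A}
    {y : Matrix (Fin m) (Fin m) A} {g : ℝ}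
    (hx : algebraMap ℝ (MatAlg n A) g ≤ CFC.abs (toMatAlg x))
    (hy : algebraMap ℝ (MatAlg m A) g ≤ CFC.abs (toMatAlg y)) :
    algebraMap ℝ (MatAlg (n + m) A) g ≤ CFC.abs (toMatAlg (matrixSum x y)) := by
  rw [← sub_nonneg] at hx hy ⊢
  rw [abs_toMatAlg_matrixSum]
  rw [← toMatAlg_smul_diagonal_one] at hx hy ⊢
  rw [← matrixSum_diagonal, ← matrixSum_smul, ← map_sub, ← matrixSum_sub]
  exact toMatAlg_matrixSum_nonneg hx hy

theorem algebraMap_le_algebraMap_real {B : Type*} [CStarAlgebra B] [PartialOrder B]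
    [StarOrderedRing B] {g g' : ℝ} (h : g ≤ g') : algebraMap ℝ B g ≤ algebraMap ℝ B g' := by
  rw [← sub_nonneg, ← map_sub, Algebra.algebraMap_eq_smul_one]
  exact smul_nonneg (sub_nonneg.mpr h) zero_le_one

theorem scalar_star_mul {A : Type u} [CStarAlgebra A] {n : ℕ} {u : Matrix (Fin n) (Fin n) ℂ} (hu : star u * u = 1) :
    (u.map (algebraMap ℂ A)).conjTranspose * u.map (algebraMap ℂ A) = 1 := by
  have h := congrArg (fun v => v.map (algebraMap ℂ A)) hu
  simp only [Matrix.map_mul] at h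
  rw [Matrix.map_one _ (map_zero _) (map_one _)] at h
  rw [← h]
  congr 1
  ext i j
  exact (algebraMap_star_comm (u j i)).symm

theorem scalar_mul_star {A : Type u} [CStarAlgebra A] {n : ℕ} {u : Matrix (Fin n) (Fin n) ℂ} (hu : star u * u = 1) :
    u.map (algebraMap ℂ A) * (u.map (algebraMap ℂ A)).conjTranspose = 1 := by
  have h := scalar_star_mul (A := A) (u := star u) (by rw [star_star]; exact mul_eq_one_comm.mp hu)
  rw [← h]
  congr 1
  · ext i j
    rw [Matrix.conjTranspose_apply, Matrix.map_apply, Matrix.map_apply, ← algebraMap_star_comm,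
      Matrix.star_apply, star_star]
  · ext i j
    exact (algebraMap_star_comm (u j i)).symm

theorem algebraMap_le_abs_compress {n : ℕ} {u : Matrix (Fin n) (Fin n) ℂ} (hu : star u * u = 1)
    {x : Matrix (Fin n) (Fin n) A} {g : ℝ}
    (hx : algebraMap ℝ (MatAlg n A) g ≤ CFC.abs (toMatAlg x)) :
    algebraMap ℝ (MatAlg n A) g ≤ CFC.abs (toMatAlg (compress u x)) := by
  have h₁ := scalar_star_mul (A := A) hu
  have h₂ := scalar_mul_star (A := A) hu
  rw [compress_eq_mul]
  rw [← Matrix.star_eq_conjTranspose] at h₁ h₂ ⊢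
  have h₁' := congrArg toMatAlg h₁
  have h₂' := congrArg toMatAlg h₂
  rw [map_mul, map_star, map_one] at h₁' h₂'
  rw [map_mul, map_mul, map_star]
  generalize toMatAlg (u.map (algebraMap ℂ A)) = U at h₁' h₂' ⊢
  generalize toMatAlg x = X at hx ⊢
  have : CFC.abs (star U * (X * U)) = star U * CFC.abs X * U := by
    refine CFC.sqrt_unique ?_ (star_left_conjugate_nonneg (CFC.abs_nonneg X) U)
    calc star U * CFC.abs X * U * (star U * CFC.abs X * U)
        = star U * CFC.abs X * (U * star U) * CFC.abs X * U := by simp only [mul_assoc]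
      _ = star U * (CFC.abs X * CFC.abs X) * U := by rw [h₂', mul_one]; simp only [mul_assoc]
      _ = star U * (star X * (U * star U) * X) * U := by rw [CFC.abs_mul_abs, h₂', mul_one]
      _ = star (star U * (X * U)) * (star U * (X * U)) := by
        simp only [star_mul, star_star, mul_assoc]
  rw [this]
  have h := star_left_conjugate_le_conjugate hx U
  rwa [mul_assoc, Algebra.commutes, ← mul_assoc, h₁', one_mul] at h

end AbsoluteValues

section HermitianForms

variable {E : Type u} [AddCommGroup E] [Module ℂ E] [StarAddMonoid E] [StarModule ℂ E]
  [UnitalOperatorSystem E]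

open UnitalOperatorSystem

theorem cone_matrixSum {n m : ℕ} {x : Matrix (Fin n) (Fin n) E} {y : Matrix (Fin m) (Fin m) E}
    (hx : x ∈ cone n) (hy : y ∈ cone m) : matrixSum x y ∈ cone (n + m) := by
  let α : Matrix (Fin n) (Fin (n + m)) ℂ :=
    Matrix.of fun i => Fin.addCases (fun j => if i = j then 1 else 0) (fun _ => 0)
  let β : Matrix (Fin m) (Fin (n + m)) ℂ :=
    Matrix.of fun i => Fin.addCases (fun _ => 0) (fun j => if i = j then 1 else 0)
  have : matrixSum x y = compress α x + compress β y := by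
    refine matrix_ext_blocks ?_ ?_ ?_ ?_ <;> intro i j <;>
      simp [matrixSum_castAdd_castAdd, matrixSum_castAdd_natAdd, matrixSum_natAdd_castAdd,
        matrixSum_natAdd_natAdd, compress, α, β]
  rw [this]
  exact add_mem (compress_mem α hx) (compress_mem β hy)

theorem IsHermForm.matrixSum {n m : ℕ} {x : Matrix (Fin n) (Fin n) E}
    {y : Matrix (Fin m) (Fin m) E} (hx : IsHermForm x) (hy : IsHermForm y) :
    IsHermForm (matrixSum x y) := by
  obtain ⟨hx, g, hg, hxg⟩ := hx
  obtain ⟨hy, g', hg', hyg⟩ := hy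
  refine ⟨?_, min g g', lt_min hg hg', fun H _ _ _ φ hφ hφ' => ?_⟩
  · rw [Matrix.IsHermitian, matrixSum_conjTranspose, hx, hy]
  · rw [matrixSum_map _ (map_zero φ)]
    exact algebraMap_le_abs_matrixSum
      ((algebraMap_le_algebraMap_real (min_le_left g g')).trans (hxg H φ hφ hφ'))
      ((algebraMap_le_algebraMap_real (min_le_right g g')).trans (hyg H φ hφ hφ'))

theorem isHermForm_unit (n : ℕ) : IsHermForm (Matrix.diagonal fun _ : Fin n => (e : E)) := by
  refine ⟨isHermitian_of_mem (unit_mem n), 1, one_pos, fun H _ _ _ φ _ hφ => ?_⟩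
  have h1 : φ e = 1 := hφ.1.2
  rw [Matrix.diagonal_map (map_zero φ), map_one]
  simp only [h1]
  rw [Matrix.diagonal_one, map_one]
  exact (CFC.abs_of_nonneg _ zero_le_one).ge

theorem IsHermForm.compress {n : ℕ} {u : Matrix (Fin n) (Fin n) ℂ} (hu : star u * u = 1)
    {x : Matrix (Fin n) (Fin n) E} (hx : IsHermForm x) : IsHermForm (compress u x) := by
  obtain ⟨hx, g, hg, hxg⟩ := hx
  refine ⟨compress_isHermitian u hx, g, hg, fun H _ _ _ φ hφ hφ' => ?_⟩
  rw [compress_map]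
  exact algebraMap_le_abs_compress hu (hxg H φ hφ hφ')

/-- A path in `H(E, n)` is continuous if it is so for the order norm. -/
theorem continuous_of_orderNormLE {T : Type*} [PseudoMetricSpace T] {n : ℕ} {f : T → HermForm E n}
    (h : ∀ t, ∀ ε > 0, ∃ δ > 0, ∀ s, dist s t < δ → OrderNormLE ((f s).val - (f t).val) ε) :
    Continuous f := by
  refine continuous_def.mpr fun U hU => Metric.isOpen_iff.mpr fun t ht => ?_
  obtain ⟨ε, hε, hU'⟩ := hU (f t) ht
  obtain ⟨δ, hδ, hf⟩ := h t ε hε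
  exact ⟨δ, hδ, fun s hs => hU' _ (hf s hs)⟩

theorem OrderNormLE.add {n : ℕ} {x y : Matrix (Fin n) (Fin n) E} {ε δ : ℝ}
    (hx : OrderNormLE x ε) (hy : OrderNormLE y δ) : OrderNormLE (x + y) (ε + δ) := by
  constructor
  · have := add_mem hx.1 hy.1
    rwa [add_add_add_comm, ← add_smul, ← Complex.ofReal_add] at this
  · have := add_mem hx.2 hy.2
    rwa [sub_add_sub_comm, ← add_smul, ← Complex.ofReal_add] at this

theorem OrderNormLE.smul {n : ℕ} {x : Matrix (Fin n) (Fin n) E} {ε : ℝ}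
    (hx : OrderNormLE x ε) (r : ℝ) : OrderNormLE ((r : ℂ) • x) (|r| * ε) := by
  rcases le_total 0 r with hr | hr
  · rw [abs_of_nonneg hr]
    constructor
    · have := smul_mem hr hx.1
      rwa [smul_add, smul_smul, ← Complex.ofReal_mul] at this
    · have := smul_mem hr hx.2
      rwa [smul_sub, smul_smul, ← Complex.ofReal_mul] at this
  · rw [abs_of_nonpos hr]
    have hr' : 0 ≤ -r := neg_nonneg.mpr hr
    constructor
    · have := smul_mem hr' hx.2
      rw [smul_sub, smul_smul, ← Complex.ofReal_mul] at this
      simpa [sub_eq_add_neg] using this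
    · have := smul_mem hr' hx.1
      rw [smul_add, smul_smul, ← Complex.ofReal_mul] at this
      simpa [sub_eq_add_neg] using this

theorem exists_orderNormLE {n : ℕ} {x : Matrix (Fin n) (Fin n) E} (hx : x.IsHermitian) :
    ∃ r : ℝ, 0 < r ∧ OrderNormLE x r := by
  obtain ⟨r, hr, h⟩ := orderUnit hx
  obtain ⟨s, hs, h'⟩ := orderUnit hx.neg
  have key := fun (t : ℝ) (ht : 0 ≤ t) => smul_mem ht (unit_mem (E := E) n)
  refine ⟨r + s, by positivity, ?_, ?_⟩
  · have := add_mem (key s hs.le) h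
    rwa [← add_assoc, ← add_smul, ← Complex.ofReal_add, add_comm s r] at this
  · have := add_mem (key r hr.le) h'
    rwa [← add_assoc, ← add_smul, ← Complex.ofReal_add, ← sub_eq_add_neg] at this

/-- Real linear combinations of self-adjoint matrices depend continuously on the coefficients. -/
theorem orderNormLE_sum {ι : Type*} (s : Finset ι) {n : ℕ} (w : ι → Matrix (Fin n) (Fin n) E)
    (hw : ∀ i, (w i).IsHermitian) : ∃ R : ℝ, 0 < R ∧ ∀ (δ : ℝ) (c : ι → ℝ),
      0 ≤ δ → (∀ i, |c i| ≤ δ) → OrderNormLE (∑ i ∈ s, (c i : ℂ) • w i) (δ * R) := by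
  classical
  induction s using Finset.induction_on with
  | empty =>
    refine ⟨1, one_pos, fun δ c hδ _ => ?_⟩
    have := smul_mem hδ (unit_mem (E := E) n)
    simp only [Finset.sum_empty, mul_one]
    exact ⟨by rwa [add_zero], by rwa [sub_zero]⟩
  | insert a s ha ih =>
    obtain ⟨R, hR, h⟩ := ih
    obtain ⟨r, hr, h'⟩ := exists_orderNormLE (hw a)
    refine ⟨r + R, by positivity, fun δ c hδ hc => ?_⟩
    rw [Finset.sum_insert ha, mul_add]
    exact ((h'.smul (c a)).mono (mul_le_mul_of_nonneg_right (hc a) hr.le)).add (h δ c hδ hc)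

/-- A self-adjoint combination of matrices with continuous coefficients is continuous. -/
theorem continuous_of_combination {T : Type*} [PseudoMetricSpace T] {ι : Type*} [Fintype ι] {n : ℕ}
    (c : T → ι → ℂ) (hc : ∀ i, Continuous fun t => c t i) (w : ι → Matrix (Fin n) (Fin n) E)
    (f : T → HermForm E n) (hf : ∀ t, (f t).val = ∑ i, c t i • w i) : Continuous f := by
  let v : ι ⊕ ι → Matrix (Fin n) (Fin n) E :=
    Sum.elim (fun i => (1 / 2 : ℂ) • (w i + (w i).conjTranspose))
      (fun i => (-Complex.I / 2 : ℂ) • (w i - (w i).conjTranspose))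
  have hv : ∀ i, (v i).IsHermitian := by
    rintro (i | i)
    · exact (isHermitian_sum_unit (w i)).1
    · exact (isHermitian_sum_unit (w i)).2
  let d : T → ι ⊕ ι → ℝ := fun t => Sum.elim (fun i => (c t i).re) (fun i => -(c t i).im)
  have hd : ∀ i, Continuous fun t => d t i := by
    rintro (i | i)
    · exact Complex.continuous_re.comp (hc i)
    · exact (Complex.continuous_im.comp (hc i)).neg
  have hfd : ∀ t, (f t).val = ∑ i, (d t i : ℂ) • v i := by
    intro t
    have h1 : (f t).val = (1 / 2 : ℂ) • ((f t).val + (f t).val.conjTranspose) := by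
      rw [(f t).property.1.eq, ← two_smul ℂ, smul_smul]
      norm_num
    rw [h1, hf t, Matrix.conjTranspose_sum, ← Finset.sum_add_distrib, Finset.smul_sum,
      Fintype.sum_sum_type, ← Finset.sum_add_distrib]
    refine Finset.sum_congr rfl fun i _ => ?_
    simp only [Matrix.conjTranspose_smul, d, v, Sum.elim_inl, Sum.elim_inr, smul_add, smul_sub,
      smul_smul]
    have e1 : (1 / 2 : ℂ) * c t i = (c t i).re * (1 / 2) +
        ((-(c t i).im : ℝ) : ℂ) * (-Complex.I / 2) := by
      conv_lhs => rw [← Complex.re_add_im (c t i)]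
      push_cast
      ring
    have e2 : (1 / 2 : ℂ) * star (c t i) = (c t i).re * (1 / 2) -
        ((-(c t i).im : ℝ) : ℂ) * (-Complex.I / 2) := by
      conv_lhs => rw [← Complex.re_add_im (c t i)]
      simp only [star_add, Complex.star_def, map_mul, Complex.conj_ofReal, Complex.conj_I]
      push_cast
      ring
    rw [e1, e2, add_smul, sub_smul]
    abel
  obtain ⟨R, hR, hsum⟩ := orderNormLE_sum Finset.univ v hv
  refine continuous_of_orderNormLE fun t ε hε => ?_
  have hd' : Continuous fun t => d t := continuous_pi hd
  obtain ⟨δ, hδ, h⟩ := Metric.continuous_iff.mp hd' t (ε / R) (by positivity)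
  refine ⟨δ, hδ, fun s hs => ?_⟩
  have := hsum (ε / R) (fun i => d s i - d t i) (by positivity) fun i => by
    have h1 := (dist_le_pi_dist (d s) (d t) i).trans (h s hs).le
    rwa [Real.dist_eq] at h1
  rw [div_mul_cancel₀ _ hR.ne'] at this
  rw [hfd s, hfd t, ← Finset.sum_sub_distrib]
  simpa only [Complex.ofReal_sub, sub_smul] using this

theorem HermForm.ext' {n : ℕ} {x y : HermForm E n} (h : x.val = y.val) : x = y := by
  cases x
  cases y
  cases h
  rfl

theorem HermForm.joined_swap {n : ℕ} (a b : Fin n) (x y : HermForm E n)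
    (h : y.val = x.val.submatrix (Equiv.swap a b) (Equiv.swap a b)) : Joined x y := by
  have hs := unitaryPath_star_mul (star_permMatrix_swap a b) (permMatrix_swap_mul_self a b)
  let f : unitInterval → HermForm E n := fun t =>
    ⟨compress (unitaryPath ((Equiv.swap a b)⁻¹.permMatrix ℂ) t) x.val, x.property.compress (hs t)⟩
  have hf : Continuous f := by
    refine continuous_of_combination _ (fun p => ?_) _ f
      (fun t => compress_eq_combination _ _)
    have h1 := fun i j => (continuous_unitaryPath ((Equiv.swap a b)⁻¹.permMatrix ℂ) i j).comp
      (continuous_subtype_val (p := fun t : ℝ => t ∈ unitInterval))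
    exact (h1 p.2.1 p.1.1).star.mul (h1 p.2.2 p.1.2)
  refine ⟨⟨⟨f, hf⟩, HermForm.ext' ?_, HermForm.ext' ?_⟩⟩
  · change compress (unitaryPath _ ((0 : unitInterval) : ℝ)) x.val = x.val
    rw [Set.Icc.coe_zero, unitaryPath_zero]
    ext i j
    simp [compress, Matrix.one_apply, apply_ite (star : ℂ → ℂ)]
  · change compress (unitaryPath _ ((1 : unitInterval) : ℝ)) x.val = y.val
    rw [Set.Icc.coe_one, unitaryPath_one, compress_permMatrix, h]

theorem IsHermForm.submatrix {n : ℕ} (σ : Equiv.Perm (Fin n)) {x : Matrix (Fin n) (Fin n) E}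
    (hx : IsHermForm x) : IsHermForm (x.submatrix σ σ) := by
  rw [← compress_permMatrix]
  refine hx.compress ?_
  rw [Matrix.star_eq_conjTranspose, Matrix.conjTranspose_permMatrix, ← Matrix.permMatrix_mul]
  simp

theorem HermForm.joined_perm {n : ℕ} (σ : Equiv.Perm (Fin n)) : ∀ x y : HermForm E n,
    y.val = x.val.submatrix σ σ → Joined x y := by
  induction σ using Equiv.Perm.swap_induction_on with
  | one =>
    intro x y h
    rw [HermForm.ext' (x := y) (y := x) h]
  | swap_mul f a b _ ih =>
    intro x y h
    let z : HermForm E n := ⟨_, x.property.submatrix (Equiv.swap a b)⟩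
    exact (HermForm.joined_swap a b x z rfl).trans (ih z y h)

theorem HermForm.joined_dsum {n m : ℕ} {x x' : HermForm E n} {y y' : HermForm E m}
    (hx : Joined x x') (hy : Joined y y') :
    Joined (⟨_, x.property.matrixSum y.property⟩ : HermForm E (n + m))
      ⟨_, x'.property.matrixSum y'.property⟩ := by
  have h₁ : Continuous fun z : HermForm E n =>
      (⟨_, z.property.matrixSum y.property⟩ : HermForm E (n + m)) := by
    refine continuous_def.mpr fun U hU z hz => ?_
    obtain ⟨ε, hε, h⟩ := hU _ hz
    refine ⟨ε, hε, fun w hw => h _ ?_⟩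
    have key := smul_mem hε.le (unit_mem (E := E) m)
    rw [← matrixSum_sub, sub_self]
    constructor
    · rw [← matrixSum_diagonal, ← matrixSum_smul, ← matrixSum_add, add_zero]
      exact cone_matrixSum hw.1 key
    · rw [← matrixSum_diagonal, ← matrixSum_smul, ← matrixSum_sub, sub_zero]
      exact cone_matrixSum hw.2 key
  have h₂ : Continuous fun z : HermForm E m =>
      (⟨_, x'.property.matrixSum z.property⟩ : HermForm E (n + m)) := by
    refine continuous_def.mpr fun U hU z hz => ?_
    obtain ⟨ε, hε, h⟩ := hU _ hz
    refine ⟨ε, hε, fun w hw => h _ ?_⟩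
    have key := smul_mem hε.le (unit_mem (E := E) n)
    rw [← matrixSum_sub, sub_self]
    constructor
    · rw [← matrixSum_diagonal, ← matrixSum_smul, ← matrixSum_add, add_zero]
      exact cone_matrixSum key hw.1
    · rw [← matrixSum_diagonal, ← matrixSum_smul, ← matrixSum_sub, sub_zero]
      exact cone_matrixSum key hw.2
  exact (hx.map h₁).trans (hy.map h₂)

theorem HermForm.sigma_eq {n m : ℕ} (h : n = m) (x : HermForm E n) (y : HermForm E m)
    (hxy : x.val = y.val.submatrix (Fin.cast h) (Fin.cast h)) :
    (⟨n, x⟩ : Σ n, HermForm E n) = ⟨m, y⟩ := by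
  subst h
  rw [HermForm.ext' (x := x) (y := y) hxy]

variable (E) in
/-- Hermitian forms with their direct sum, stabilized by the units `e_n`. -/
def hermSystem : SumSystem (HermForm E) where
  dsum x y := ⟨matrixSum x.val y.val, x.property.matrixSum y.property⟩
  base n := ⟨Matrix.diagonal fun _ => e, isHermForm_unit n⟩
  base_dsum n m := HermForm.ext' (matrixSum_diagonal e n m)
  joined_dsum hx hy := HermForm.joined_dsum hx hy
  dsum_assoc {n m k} x y z := HermForm.sigma_eq (Nat.add_assoc n m k) _ _ (matrixSum_assoc _ _ _)
  dsum_base_zero {n} x := HermForm.sigma_eq (Nat.add_zero n) _ _ (by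
    refine matrix_ext_blocks ?_ ?_ ?_ ?_ <;> intro i j
    · exact matrixSum_castAdd_castAdd x.val _ i j
    · exact j.elim0
    · exact i.elim0
    · exact i.elim0)
  dsum_comm {n m} x y := by
    let z : HermForm E (n + m) :=
      ⟨matrixSum x.val y.val, x.property.matrixSum y.property⟩
    let σ : Equiv.Perm (Fin (n + m)) := (finCongr (Nat.add_comm n m)).trans finAddFlip
    refine ⟨n + m, z, ⟨z.val.submatrix σ σ, z.property.submatrix σ⟩, rfl,
      HermForm.sigma_eq (Nat.add_comm m n) _ _ ?_, HermForm.joined_perm σ _ _ rfl⟩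
    exact matrixSum_comm x.val y.val

variable (E) in
/-- The semigroup `𝒱(E)` of hermitian forms over the operator system `E`: classes of hermitian
forms under `x ∼ x'` if `x ⊕ e_{k-n} ∼ x' ⊕ e_{k-n'}` in `π₀ (H(E, k))` for some `k ≥ n, n'`,
with the direct sum. -/
abbrev HermClasses : Type u := (hermSystem E).Classes

/-- The class `[x] ∈ 𝒱(E)` of a hermitian form `x ∈ H(E, n)`. -/
def HermForm.toClass {n : ℕ} (x : HermForm E n) : HermClasses E := (hermSystem E).classOf x

variable (E) in
/-- The K-theory group `K₀(E)` of a unital operator system. -/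
abbrev OperatorSystemK0 : Type u := Algebra.GrothendieckAddGroup (HermClasses E)

end HermitianForms

/-! ## The K₀-group of a unital C*-algebra -/

section Projections

variable {A : Type u} [CStarAlgebra A] [PartialOrder A] [StarOrderedRing A]

variable (A) in
/-- The space of projections in the C*-algebra `M_n(A)`, with the norm topology. -/
abbrev Proj (n : ℕ) : Type u := {p : MatAlg n A // IsStarProjection p}

theorem isStarProjection_toMatAlg {n : ℕ} {p : Matrix (Fin n) (Fin n) A} :
    IsStarProjection (toMatAlg p) ↔ p * p = p ∧ p.conjTranspose = p := by
  rw [isStarProjection_iff', ← map_mul, ← map_star]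
  exact and_congr toMatAlg.injective.eq_iff toMatAlg.injective.eq_iff

theorem isStarProjection_matrixSum {n m : ℕ} {p : Matrix (Fin n) (Fin n) A}
    {q : Matrix (Fin m) (Fin m) A} (hp : IsStarProjection (toMatAlg p))
    (hq : IsStarProjection (toMatAlg q)) : IsStarProjection (toMatAlg (matrixSum p q)) := by
  rw [isStarProjection_toMatAlg] at *
  rw [← matrixSum_mul, matrixSum_conjTranspose, hp.1, hp.2, hq.1, hq.2]
  exact ⟨rfl, rfl⟩

/-- The direct sum of projections. -/
noncomputable def Proj.dsum {n m : ℕ} (p : Proj A n) (q : Proj A m) : Proj A (n + m) :=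
  ⟨toMatAlg (matrixSum (toMatAlg.symm p.1) (toMatAlg.symm q.1)),
    isStarProjection_matrixSum p.2 q.2⟩

theorem isStarProjection_compress {n : ℕ} {u : Matrix (Fin n) (Fin n) ℂ} (hu : star u * u = 1)
    {p : Matrix (Fin n) (Fin n) A} (hp : IsStarProjection (toMatAlg p)) :
    IsStarProjection (toMatAlg (compress u p)) := by
  rw [isStarProjection_toMatAlg] at *
  refine ⟨?_, compress_isHermitian u hp.2⟩
  have h := scalar_mul_star (A := A) hu
  rw [compress_eq_mul]
  generalize u.map (algebraMap ℂ A) = U at h ⊢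
  calc U.conjTranspose * (p * U) * (U.conjTranspose * (p * U))
      = U.conjTranspose * (p * (U * U.conjTranspose) * p * U) := by
        simp only [Matrix.mul_assoc]
    _ = U.conjTranspose * (p * U) := by rw [h, Matrix.mul_one, hp.1]

theorem Proj.joined_swap {n : ℕ} (a b : Fin n) (p q : Proj A n)
    (h : toMatAlg.symm q.1 =
      (toMatAlg.symm p.1).submatrix (Equiv.swap a b) (Equiv.swap a b)) : Joined p q := by
  have hs := unitaryPath_star_mul (star_permMatrix_swap a b) (permMatrix_swap_mul_self a b)
  let f : unitInterval → Proj A n := fun t =>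
    ⟨toMatAlg (compress (unitaryPath ((Equiv.swap a b)⁻¹.permMatrix ℂ) t) (toMatAlg.symm p.1)),
      isStarProjection_compress (hs t) p.2⟩
  have hf : Continuous f := by
    refine Continuous.subtype_mk (continuous_toMatAlg.comp ?_) _
    have h1 := fun i j => (continuous_unitaryPath ((Equiv.swap a b)⁻¹.permMatrix ℂ) i j).comp
      (continuous_subtype_val (p := fun t : ℝ => t ∈ unitInterval))
    refine continuous_matrix fun i j => ?_
    simp only [compress, Matrix.of_apply]
    refine continuous_finsetSum _ fun k _ => continuous_finsetSum _ fun l _ => ?_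
    exact ((h1 k i).star.mul (h1 l j)).smul continuous_const
  refine ⟨⟨⟨f, hf⟩, Subtype.ext ?_, Subtype.ext ?_⟩⟩
  · change toMatAlg (compress (unitaryPath _ ((0 : unitInterval) : ℝ)) (toMatAlg.symm p.1)) = p.1
    rw [Set.Icc.coe_zero, unitaryPath_zero]
    refine (congrArg toMatAlg ?_ : _ = toMatAlg (toMatAlg.symm p.1))
    ext i j
    simp [compress, Matrix.one_apply, apply_ite (star : ℂ → ℂ)]
  · change toMatAlg (compress (unitaryPath _ ((1 : unitInterval) : ℝ)) (toMatAlg.symm p.1)) = q.1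
    rw [Set.Icc.coe_one, unitaryPath_one, compress_permMatrix, ← h]
    rfl

theorem isStarProjection_submatrix {n : ℕ} (σ : Equiv.Perm (Fin n))
    {p : Matrix (Fin n) (Fin n) A} (hp : IsStarProjection (toMatAlg p)) :
    IsStarProjection (toMatAlg (p.submatrix σ σ)) := by
  rw [← compress_permMatrix]
  refine isStarProjection_compress ?_ hp
  rw [Matrix.star_eq_conjTranspose, Matrix.conjTranspose_permMatrix, ← Matrix.permMatrix_mul]
  simp

theorem Proj.joined_perm {n : ℕ} (σ : Equiv.Perm (Fin n)) : ∀ p q : Proj A n,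
    toMatAlg.symm q.1 = (toMatAlg.symm p.1).submatrix σ σ → Joined p q := by
  induction σ using Equiv.Perm.swap_induction_on with
  | one =>
    intro p q h
    rw [show q = p from Subtype.ext h]
  | swap_mul f a b _ ih =>
    intro p q h
    let z : Proj A n := ⟨toMatAlg ((toMatAlg.symm p.1).submatrix (Equiv.swap a b)
      (Equiv.swap a b)), isStarProjection_submatrix _ p.2⟩
    exact (Proj.joined_swap a b p z rfl).trans (ih z q h)

theorem Proj.joined_dsum {n m : ℕ} {p p' : Proj A n} {q q' : Proj A m} (hp : Joined p p')
    (hq : Joined q q') : Joined (Proj.dsum p q) (Proj.dsum p' q') := by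
  have h₁ : Continuous fun z : Proj A n => Proj.dsum z q :=
    Continuous.subtype_mk (continuous_toMatAlg.comp (continuous_matrixSum.comp
      ((continuous_toMatAlg_symm.comp continuous_subtype_val).prodMk continuous_const))) _
  have h₂ : Continuous fun z : Proj A m => Proj.dsum p' z :=
    Continuous.subtype_mk (continuous_toMatAlg.comp (continuous_matrixSum.comp
      (continuous_const.prodMk (continuous_toMatAlg_symm.comp continuous_subtype_val)))) _
  exact (hp.map h₁).trans (hq.map h₂)

theorem Proj.sigma_eq {n m : ℕ} (h : n = m) (p : Proj A n) (q : Proj A m)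
    (hpq : toMatAlg.symm p.1 = (toMatAlg.symm q.1).submatrix (Fin.cast h) (Fin.cast h)) :
    (⟨n, p⟩ : Σ n, Proj A n) = ⟨m, q⟩ := by
  subst h
  rw [show p = q from Subtype.ext hpq]

variable (A) in
/-- Projections with their direct sum, stabilized by the zero projections. -/
noncomputable def projSystem : SumSystem (Proj A) where
  dsum p q := Proj.dsum p q
  base n := ⟨0, .zero _⟩
  base_dsum n m := Subtype.ext <| by
    change toMatAlg (matrixSum (toMatAlg.symm 0) (toMatAlg.symm 0)) = 0
    rw [map_zero, map_zero, ← map_zero (toMatAlg (A := A) (n := n + m))]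
    congr 1
    refine matrix_ext_blocks ?_ ?_ ?_ ?_ <;> intro i j <;>
      simp only [Matrix.zero_apply, matrixSum_castAdd_castAdd, matrixSum_castAdd_natAdd,
        matrixSum_natAdd_castAdd, matrixSum_natAdd_natAdd]
  joined_dsum hp hq := Proj.joined_dsum hp hq
  dsum_assoc {n m k} p q r := Proj.sigma_eq (Nat.add_assoc n m k) _ _ (matrixSum_assoc _ _ _)
  dsum_base_zero {n} p := Proj.sigma_eq (Nat.add_zero n) _ _ (by
    refine matrix_ext_blocks ?_ ?_ ?_ ?_ <;> intro i j
    · exact matrixSum_castAdd_castAdd (toMatAlg.symm p.1) _ i j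
    · exact j.elim0
    · exact i.elim0
    · exact i.elim0)
  dsum_comm {n m} p q := by
    let z : Proj A (n + m) := Proj.dsum p q
    let σ : Equiv.Perm (Fin (n + m)) := (finCongr (Nat.add_comm n m)).trans finAddFlip
    refine ⟨n + m, z, ⟨toMatAlg ((toMatAlg.symm z.1).submatrix σ σ),
      isStarProjection_submatrix σ z.2⟩, rfl,
      Proj.sigma_eq (Nat.add_comm m n) _ _ ?_, Proj.joined_perm σ _ _ rfl⟩
    exact matrixSum_comm (toMatAlg.symm p.1) (toMatAlg.symm q.1)

variable (A) in
/-- The semigroup of homotopy classes of projections in `M_∞(A) = ⋃ M_n(A)`, where `M_n(A)` is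
included in `M_k(A)` by `p ↦ p ⊕ 0`, with the direct sum. -/
abbrev ProjClasses : Type u := (projSystem A).Classes

/-- The class `[p]` of a projection `p ∈ M_n(A)`. -/
noncomputable def Proj.toClass {n : ℕ} (p : Proj A n) : ProjClasses A := (projSystem A).classOf p

variable (A) in
/-- The C*-algebraic K-theory group `K₀(A)` of a unital C*-algebra. -/
abbrev CStarK0 : Type u := Algebra.GrothendieckAddGroup (ProjClasses A)

end Projections

/-! Over a C*-algebra `A` the hermitian forms are exactly the invertible self-adjoint matrices. Once
this is known, the theorem is the usual passage between an invertible self-adjoint element and its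
negative spectral projection.

If `x` is invertible then `|x| ≥ g` in `M_n(A)` for some `g > 0`. A maximal ucp map is a
`*`-representation: its Stinespring dilation must split, so its compression is multiplicative
(`IsMaximalUCP.exists_starAlgHom`). Representations preserve order and absolute values, so the bound
persists (`isHermForm_of_isUnit`).

Conversely, if `x` is singular, some pure state `ω` of `M_n(A)` kills `x* x`: states killing a
positive element form a weak-* compact face of the state space, which has an extreme point
(`exists_pure_state_eq_zero`). GNS on `A ^ n` turns `ω` into a representation `π` of `A` with a
cyclic tuple `ξ` of vectors satisfying `π(x) ξ = 0`. It is maximal as a representation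
(`StarAlgHom.isMaximalUCP`) and pure because `ω` is (`isPureCP_of_pure_state`), so no bound `|π(x)|
≥ g` can hold (`IsHermForm.isUnit`).

On invertible self-adjoint elements the order norm gives the norm topology, and `x ↦ x|x|⁻¹` is
continuous. The maps `x ↦ (1 - x|x|⁻¹)/2` and `p ↦ 1 - 2p` are thus homotopy inverse to each other.
The first respects direct sums and sends units to zeros, so it induces an isomorphism of stable
homotopy classes (`SumSystem.exists_classesEquiv`) and then of Grothendieck groups. -/

open scoped InnerProductSpace ComplexOrder

open UnitalOperatorSystem

/-! ### The GNS construction for semi-inner products -/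

/-- The Gelfand–Naimark–Segal construction: a `*`-compatible action of a C*-algebra `A` on a
semi-inner product space `M` gives a `*`-representation on the Hilbert space of `M`. -/
theorem exists_representation {A : Type u} [CStarAlgebra A] {M : Type u} [AddCommGroup M]
    [Module ℂ M] (c : PreInnerProductSpace.Core ℂ M) (ρ : A → M →ₗ[ℂ] M)
    (ρ_one : ∀ m, ρ 1 m = m) (ρ_mul : ∀ a b m, ρ (a * b) m = ρ a (ρ b m))
    (ρ_star : ∀ a m m', c.inner (ρ a m) m' = c.inner m (ρ (star a) m'))
    (ρ_add : ∀ a b m m', c.inner m (ρ (a + b) m') = c.inner m (ρ a m') + c.inner m (ρ b m'))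
    (ρ_smul : ∀ (z : ℂ) a m m', c.inner m (ρ (z • a) m') = z * c.inner m (ρ a m')) :
    ∃ (K : Type u) (_ : NormedAddCommGroup K) (_ : InnerProductSpace ℂ K) (_ : CompleteSpace K)
      (j : M →ₗ[ℂ] K) (π : A →⋆ₐ[ℂ] (K →L[ℂ] K)), DenseRange j ∧
        (∀ m m', ⟪j m, j m'⟫_ℂ = c.inner m m') ∧ ∀ a m, π a (j m) = j (ρ a m) := by
  let : SeminormedAddCommGroup M := InnerProductSpace.Core.toSeminormedAddCommGroup (c := c)
  let : InnerProductSpace ℂ M := InnerProductSpace.ofCore c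
  have hc : ∀ m m', c.inner m m' = ⟪m, m'⟫_ℂ := fun _ _ => rfl
  simp only [hc] at ρ_star ρ_add ρ_smul
  let : PartialOrder A := CStarAlgebra.spectralOrder A
  have : StarOrderedRing A := CStarAlgebra.spectralOrderedRing A
  have bound : ∀ a m, ‖ρ a m‖ ≤ ‖a‖ * ‖m‖ := by
    intro a m
    -- Writing `‖a‖² - a* a = b* b` gives `‖a‖² ‖m‖² = ‖ρ b m‖² + ‖ρ a m‖²`, so each `ρ a` is
    -- bounded and descends to the completion.
    have h0 : 0 ≤ algebraMap ℝ A (‖a‖ ^ 2) - star a * a := by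
      rw [sub_nonneg, sq, ← CStarRing.norm_star_mul_self]
      exact IsSelfAdjoint.le_algebraMap_norm_self (.star_mul_self a)
    obtain ⟨b, hb⟩ := CStarAlgebra.nonneg_iff_eq_star_mul_self.mp h0
    have h1 : algebraMap ℝ A (‖a‖ ^ 2) = ((‖a‖ ^ 2 : ℝ) : ℂ) • (1 : A) := by
      rw [Algebra.algebraMap_eq_smul_one]; rfl
    rw [h1, sub_eq_iff_eq_add] at hb
    have h2 := ρ_add (star b * b) (star a * a) m m
    rw [← hb, ρ_smul, ρ_one, ρ_mul, ρ_mul, ← ρ_star, ← ρ_star, inner_self_eq_norm_sq_to_K,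
      inner_self_eq_norm_sq_to_K, inner_self_eq_norm_sq_to_K] at h2
    have h3 : ‖a‖ ^ 2 * ‖m‖ ^ 2 = ‖ρ b m‖ ^ 2 + ‖ρ a m‖ ^ 2 := by
      have h4 := congrArg Complex.re h2
      simp only [← Complex.ofReal_pow, RCLike.ofReal_eq_complex_ofReal, ← Complex.ofReal_mul,
        ← Complex.ofReal_add, Complex.ofReal_re] at h4
      exact h4
    refine le_of_sq_le_sq ?_ (by positivity)
    nlinarith [sq_nonneg ‖ρ b m‖]
  let L : A → M →L[ℂ] M := fun a => (ρ a).mkContinuous ‖a‖ (bound a)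
  let K := UniformSpace.Completion M
  let j : M →ₗ[ℂ] K := (UniformSpace.Completion.toComplL (𝕜 := ℂ) (E := M)).toLinearMap
  have hdense : DenseRange j := UniformSpace.Completion.denseRange_coe
  have hinner : ∀ m m', ⟪j m, j m'⟫_ℂ = ⟪m, m'⟫_ℂ := fun m m' =>
    UniformSpace.Completion.inner_coe m m'
  let P : A → K →L[ℂ] K := fun a => (L a).completion
  have hP : ∀ a m, P a (j m) = j (ρ a m) := fun a m =>
    UniformSpace.Completion.map_coe (L a).uniformContinuous m
  -- Linearity of `ρ` in `a` is assumed only inside inner products, so operator identities are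
  -- tested on matrix coefficients over the dense image of `j`.
  have ext_op : ∀ S T : K →L[ℂ] K, (∀ m m', ⟪j m, S (j m')⟫_ℂ = ⟪j m, T (j m')⟫_ℂ) → S = T := by
    intro S T h
    refine DFunLike.coe_injective (hdense.equalizer S.continuous T.continuous (funext fun m' => ?_))
    refine ext_inner_left ℂ fun k => hdense.induction_on k (isClosed_eq ?_ ?_) fun m => h m m'
    · exact continuous_id.inner continuous_const
    · exact continuous_id.inner continuous_const
  refine ⟨K, inferInstance, inferInstance, inferInstance, j,
    { toFun := P
      map_one' := ext_op _ _ fun m m' => by rw [hP, ρ_one]; rfl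
      map_mul' := fun a b => ext_op _ _ fun m m' => by
        rw [mul_apply_eq_comp, hP, hP, hP, ρ_mul]
      map_zero' := ext_op _ _ fun m m' => by
        have := ρ_smul 0 0 m m'
        rw [zero_smul, zero_mul] at this
        rw [hP, hinner, this]; exact (inner_zero_right _).symm
      map_add' := fun a b => ext_op _ _ fun m m' => by
        rw [add_apply, inner_add_right, hP, hP, hP, hinner, hinner, hinner,
          ρ_add]
      commutes' := fun z => ext_op _ _ fun m m' => by
        rw [Algebra.algebraMap_eq_smul_one, Algebra.algebraMap_eq_smul_one, hP, hinner, ρ_smul,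
          ρ_one]
        simp [inner_smul_right, hinner]
      map_star' := fun a => ext_op _ _ fun m m' => by
        rw [ContinuousLinearMap.star_eq_adjoint, ContinuousLinearMap.adjoint_inner_right, hP, hP,
          hinner, hinner, ρ_star] }, hdense, hinner, hP⟩

/-! ### Quadratic forms of positive operator matrices -/

section PositiveOperatorMatrices

variable {H : Type u} [NormedAddCommGroup H] [InnerProductSpace ℂ H] [CompleteSpace H]

/-- A positive operator matrix is `B* B` for some operator matrix `B`. -/
theorem exists_eq_star_mul_of_mem_cone {n : ℕ} {x : Matrix (Fin n) (Fin n) (H →L[ℂ] H)}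
    (hx : x ∈ cone n) : ∃ B : Matrix (Fin n) (Fin n) (H →L[ℂ] H), x = star B * B := by
  obtain ⟨b, hb⟩ := CStarAlgebra.nonneg_iff_eq_star_mul_self.mp (show 0 ≤ toMatAlg x from hx)
  exact ⟨toMatAlg.symm b, hb⟩

theorem sum_apply_star_mul {n : ℕ} (B : Matrix (Fin n) (Fin n) (H →L[ℂ] H)) (h : Fin n → H)
    (i : Fin n) : ∑ j, (star B * B) i j (h j) =
      ∑ k, ContinuousLinearMap.adjoint (B k i) (∑ j, B k j (h j)) := by
  simp only [Matrix.mul_apply, sum_apply, map_sum]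
  rw [Finset.sum_comm]
  rfl

theorem sum_inner_star_mul {n : ℕ} (B : Matrix (Fin n) (Fin n) (H →L[ℂ] H)) (h : Fin n → H) :
    ∑ i, ∑ j, ⟪h i, (star B * B) i j (h j)⟫_ℂ = ∑ k, ((‖∑ j, B k j (h j)‖ ^ 2 : ℝ) : ℂ) := by
  simp only [← inner_sum, sum_apply_star_mul]
  simp only [inner_sum (𝕜 := ℂ) Finset.univ (fun k => ContinuousLinearMap.adjoint (B k _) _),
    ContinuousLinearMap.adjoint_inner_right]
  rw [Finset.sum_comm]
  refine Finset.sum_congr rfl fun k _ => ?_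
  rw [← sum_inner, inner_self_eq_norm_sq_to_K]
  norm_cast

theorem sum_inner_nonneg_of_mem_cone {n : ℕ} {x : Matrix (Fin n) (Fin n) (H →L[ℂ] H)}
    (hx : x ∈ cone n) (h : Fin n → H) : 0 ≤ ∑ i, ∑ j, ⟪h i, x i j (h j)⟫_ℂ := by
  obtain ⟨B, rfl⟩ := exists_eq_star_mul_of_mem_cone hx
  rw [sum_inner_star_mul]
  exact Finset.sum_nonneg fun k _ => Complex.zero_le_real.mpr (sq_nonneg _)

/-- For `x = B* B` the quadratic form at `h` is the sum of the squared norms of the entries of `B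
h`; if it vanishes, then `B h = 0` and so `x h = 0`. -/
theorem sum_apply_eq_zero_of_mem_cone {n : ℕ} {x : Matrix (Fin n) (Fin n) (H →L[ℂ] H)}
    (hx : x ∈ cone n) {h : Fin n → H} (h0 : ∑ i, ∑ j, ⟪h i, x i j (h j)⟫_ℂ = 0) (i : Fin n) :
    ∑ j, x i j (h j) = 0 := by
  obtain ⟨B, rfl⟩ := exists_eq_star_mul_of_mem_cone hx
  rw [sum_inner_star_mul, ← Complex.ofReal_sum, Complex.ofReal_eq_zero,
    Finset.sum_eq_zero_iff_of_nonneg fun k _ => sq_nonneg _] at h0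
  rw [sum_apply_star_mul]
  refine Finset.sum_eq_zero fun k hk => ?_
  rw [norm_eq_zero.mp (pow_eq_zero_iff two_ne_zero |>.mp (h0 k hk)), map_zero]

end PositiveOperatorMatrices

/-! ### Completely positive maps, and maximality of representations -/

section CompletelyPositive

variable {A : Type u} [CStarAlgebra A] [PartialOrder A] [StarOrderedRing A]
variable {B : Type u} [CStarAlgebra B] [PartialOrder B] [StarOrderedRing B]
variable {H : Type u} [NormedAddCommGroup H] [InnerProductSpace ℂ H] [CompleteSpace H]

/-- The matrices `(vᵢ* vⱼ)` are positive. -/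
theorem gram_mem_cone {n : ℕ} (v : Fin n → A) :
    (Matrix.of fun i j => star (v i) * v j) ∈ cone n := by
  have h := toMatAlg_star_mul_self_nonneg (Matrix.of fun (_ : Fin 1) j => v j)
  have hv : (Matrix.of fun i j => star (v i) * v j) =
      (Matrix.of fun (_ : Fin 1) j => v j).conjTranspose * Matrix.of fun (_ : Fin 1) j => v j := by
    ext i j
    simp [Matrix.mul_apply]
  rwa [← hv] at h

/-- A `*`-homomorphism acts entrywise on matrices as a `*`-homomorphism. -/
noncomputable def matAlgMap (n : ℕ) (π : A →⋆ₐ[ℂ] B) : MatAlg n A →⋆ₐ[ℂ] MatAlg n B where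
  toFun x := toMatAlg ((toMatAlg.symm x).map π)
  map_one' := by rw [map_one, Matrix.map_one _ (map_zero π) (map_one π), map_one]
  map_mul' x y := by rw [map_mul, Matrix.map_mul, map_mul]
  map_zero' := by rw [map_zero, Matrix.map_zero _ (map_zero π), map_zero]
  map_add' x y := by rw [map_add, Matrix.map_add _ (map_add π), map_add]
  commutes' z := by
    rw [Algebra.algebraMap_eq_smul_one, Algebra.algebraMap_eq_smul_one, map_smul,
      Matrix.map_smul _ _ (fun a => map_smul π z a), map_smul, map_one,
      Matrix.map_one _ (map_zero π) (map_one π), map_one]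
  map_star' x := by
    rw [map_star, ← map_star toMatAlg]
    congr 1
    ext i j
    simp only [Matrix.star_apply, Matrix.map_apply]
    exact map_star π _

theorem matAlgMap_toMatAlg {n : ℕ} (π : A →⋆ₐ[ℂ] B) (x : Matrix (Fin n) (Fin n) A) :
    matAlgMap n π (toMatAlg x) = toMatAlg (x.map π) := rfl

theorem StarAlgHom.map_nonneg_of_nonneg (π : A →⋆ₐ[ℂ] B) {a : A} (ha : 0 ≤ a) : 0 ≤ π a := by
  obtain ⟨b, rfl⟩ := CStarAlgebra.nonneg_iff_eq_star_mul_self.mp ha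
  rw [map_mul, map_star]
  exact star_mul_self_nonneg _

/-- Square roots of positive elements are unique, and `π(|a|)` is a positive square root of `π(a)*
π(a)`. -/
theorem StarAlgHom.map_abs (π : A →⋆ₐ[ℂ] B) (a : A) : π (CFC.abs a) = CFC.abs (π a) := by
  refine (CFC.sqrt_unique ?_ (π.map_nonneg_of_nonneg (CFC.abs_nonneg a))).symm
  rw [← map_mul, CFC.abs_mul_abs, map_mul, map_star]

theorem StarAlgHom.isCP (π : A →⋆ₐ[ℂ] B) : IsCP (π : A →ₗ[ℂ] B) := fun n _ hx =>
  (matAlgMap n π).map_nonneg_of_nonneg hx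

theorem StarAlgHom.isUCP (π : A →⋆ₐ[ℂ] B) : IsUCP (π : A →ₗ[ℂ] B) :=
  ⟨π.isCP, map_one π⟩

/-- The Gram matrix of `(1, a)` has off-diagonal entries `a` and `a*`; its image is positive, hence
self-adjoint. -/
theorem IsCP.map_star {φ : A →ₗ[ℂ] B} (hφ : IsCP φ) (a : A) : φ (star a) = star (φ a) := by
  have h := isHermitian_of_mem (hφ 2 _ (gram_mem_cone ![1, a]))
  have := h.apply 1 0
  simp at this
  rw [this]

theorem IsCP.sum_inner_nonneg {φ : A →ₗ[ℂ] (H →L[ℂ] H)} (hφ : IsCP φ) {n : ℕ} (v : Fin n → A)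
    (h : Fin n → H) : 0 ≤ ∑ i, ∑ j, ⟪h i, φ (star (v i) * v j) (h j)⟫_ℂ :=
  sum_inner_nonneg_of_mem_cone (hφ n _ (gram_mem_cone v)) h

/-- The Kadison–Schwarz inequality. -/
theorem IsUCP.norm_sq_le {φ : A →ₗ[ℂ] (H →L[ℂ] H)} (hφ : IsUCP φ) (a : A) (h : H) :
    ((‖φ a h‖ ^ 2 : ℝ) : ℂ) ≤ ⟪h, φ (star a * a) h⟫_ℂ := by
  -- With this choice of vectors the form equals `⟪h, φ(a* a) h⟫ - ‖φ(a) h‖²`.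
  have key := hφ.1.sum_inner_nonneg ![1, a] ![-φ a h, h]
  have h1 : φ 1 = 1 := hφ.2
  have h2 : ⟪φ a h, φ a h⟫_ℂ = ((‖φ a h‖ ^ 2 : ℝ) : ℂ) := by
    rw [inner_self_eq_norm_sq_to_K]; norm_cast
  simp [Fin.sum_univ_two, h1, hφ.1.map_star, ContinuousLinearMap.star_eq_adjoint,
    ContinuousLinearMap.adjoint_inner_right] at key
  rw [← h2]
  simpa [h2] using key

/-- `*`-representations are maximal. -/
theorem StarAlgHom.isMaximalUCP (π : A →⋆ₐ[ℂ] (H →L[ℂ] H)) :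
    IsMaximalUCP (π : A →ₗ[ℂ] (H →L[ℂ] H)) := by
  refine ⟨π.isUCP, fun K _ _ _ V ψ hψ hV => ?_⟩
  have hVa : ∀ a h, ContinuousLinearMap.adjoint V.toContinuousLinearMap (ψ a (V h)) = π a h :=
    fun a h => congrArg (fun T : H →L[ℂ] H => T h) (hV a)
  -- The component of `ψ(a) V h` in `V H` is `V π(a) h`, and by Kadison–Schwarz `‖ψ(a) V h‖² ≤ ⟪V h,
  -- ψ(a* a) V h⟫ = ‖π(a) h‖²`. By Pythagoras nothing is left for the orthogonal complement.
  have key : ∀ a h, ψ a (V h) = V (π a h) := by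
    intro a h
    have h1 := hψ.norm_sq_le a (V h)
    have h2 : ⟪V h, ψ (star a * a) (V h)⟫_ℂ = ((‖π a h‖ ^ 2 : ℝ) : ℂ) := by
      change ⟪V.toContinuousLinearMap h, _⟫_ℂ = _
      rw [← ContinuousLinearMap.adjoint_inner_right, hVa, map_mul, StarHomClass.map_star,
        ContinuousLinearMap.star_eq_adjoint, mul_apply_eq_comp,
        ContinuousLinearMap.adjoint_inner_right, inner_self_eq_norm_sq_to_K]
      norm_cast
    rw [h2] at h1
    have h3 : ‖ψ a (V h)‖ ^ 2 ≤ ‖π a h‖ ^ 2 := by exact_mod_cast h1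
    have h4 : RCLike.re ⟪ψ a (V h), V (π a h)⟫_ℂ = ‖π a h‖ ^ 2 := by
      change RCLike.re ⟪_, V.toContinuousLinearMap _⟫_ℂ = _
      rw [← ContinuousLinearMap.adjoint_inner_left, hVa, inner_self_eq_norm_sq]
    have h5 := @norm_sub_sq ℂ _ _ _ _ (ψ a (V h)) (V (π a h))
    rw [h4, V.norm_map] at h5
    rw [← sub_eq_zero, ← norm_eq_zero, ← pow_eq_zero_iff two_ne_zero]
    nlinarith [sq_nonneg ‖ψ a (V h) - V (π a h)‖]
  -- This is the adjoint of `key` at `star a`; together they say that `V H` reduces `ψ`.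
  have key' : ∀ a k, ContinuousLinearMap.adjoint V.toContinuousLinearMap (ψ a k) =
      π a (ContinuousLinearMap.adjoint V.toContinuousLinearMap k) := by
    intro a k
    refine ext_inner_left ℂ fun h => ?_
    have h1 : ψ a = ContinuousLinearMap.adjoint (ψ (star a)) := by
      rw [hψ.1.map_star, ContinuousLinearMap.star_eq_adjoint, ContinuousLinearMap.adjoint_adjoint]
    have h2 : π a = ContinuousLinearMap.adjoint (π (star a)) := by
      rw [StarHomClass.map_star, ContinuousLinearMap.star_eq_adjoint,
        ContinuousLinearMap.adjoint_adjoint]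
    rw [ContinuousLinearMap.adjoint_inner_right, h1, ContinuousLinearMap.adjoint_inner_right, h2,
      ContinuousLinearMap.adjoint_inner_right, ContinuousLinearMap.adjoint_inner_right]
    exact congrArg (⟪·, k⟫_ℂ) (key (star a) h)
  intro a
  ext k
  exact (congrArg V (key' a k)).trans (key a _).symm

/-- A completely positive map dominated by a `*`-representation `π` is `b ↦ T π(b)`, with `T` in
the commutant of `π`. -/
theorem IsCP.eq_mul_of_dominated {π : A →⋆ₐ[ℂ] (H →L[ℂ] H)} {ψ : A →ₗ[ℂ] (H →L[ℂ] H)}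
    (hψ : IsCP ψ) (hπψ : IsCP ((π : A →ₗ[ℂ] (H →L[ℂ] H)) - ψ)) (b : A) : ψ b = ψ 1 * π b := by
  ext h
  -- The formal vector `b ⊗ h - 1 ⊗ π(b) h` is null for the form of `π`, hence for that of the
  -- dominated map `ψ`. Row `1` of the resulting kernel equation reads `ψ(b) h = ψ(1) π(b) h`.
  have h1 := hψ.sum_inner_nonneg ![b, 1] ![h, -π b h]
  have h2 := hπψ.sum_inner_nonneg ![b, 1] ![h, -π b h]
  have h0 : ∑ i, ∑ j, ⟪(![h, -π b h] : Fin 2 → H) i, ψ (star ((![b, 1] : Fin 2 → A) i) *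
      (![b, 1] : Fin 2 → A) j) ((![h, -π b h] : Fin 2 → H) j)⟫_ℂ = 0 := by
    refine le_antisymm ?_ h1
    rw [← sub_nonneg, zero_sub]
    convert! h2 using 1
    simp [Fin.sum_univ_two]
    ring
  have := sum_apply_eq_zero_of_mem_cone (hψ 2 _ (gram_mem_cone ![b, 1])) (h := ![h, -π b h])
    (by simpa using h0) 1
  simp [Fin.sum_univ_two] at this
  rw [mul_apply_eq_comp]
  exact add_neg_eq_zero.mp this

/-- Taking adjoints in `ψ(b*) = ψ(1) π(b*)` gives `ψ(b) = π(b) ψ(1)`. -/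
theorem IsCP.commute_of_dominated {π : A →⋆ₐ[ℂ] (H →L[ℂ] H)} {ψ : A →ₗ[ℂ] (H →L[ℂ] H)}
    (hψ : IsCP ψ) (hπψ : IsCP ((π : A →ₗ[ℂ] (H →L[ℂ] H)) - ψ)) (b : A) :
    ψ 1 * π b = π b * ψ 1 := by
  have h1 : star (ψ 1) = ψ 1 := by rw [← hψ.map_star, star_one]
  have h2 := hψ.map_star (star b)
  rw [star_star, hψ.eq_mul_of_dominated hπψ, hψ.eq_mul_of_dominated hπψ (star b), star_mul, h1,
    ← StarHomClass.map_star π, star_star] at h2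
  exact h2

end CompletelyPositive

/-! ### Stinespring dilations; maximal maps are representations -/

section Stinespring

variable {A : Type u} [CStarAlgebra A] [PartialOrder A] [StarOrderedRing A]
variable {H : Type u} [NormedAddCommGroup H] [InnerProductSpace ℂ H] [CompleteSpace H]

/-- The semi-inner product `⟪a ⊗ h, b ⊗ k⟫ = ⟪h, φ(a* b) k⟫` of a completely positive map `φ`. -/
@[reducible] noncomputable def stinespringCore {φ : A →ₗ[ℂ] (H →L[ℂ] H)} (hφ : IsCP φ) :
    PreInnerProductSpace.Core ℂ (A →₀ H) where
  inner f g := f.sum fun a h => g.sum fun b k => ⟪h, φ (star a * b) k⟫_ℂ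
  conj_inner_symm f g := by
    simp only [Finsupp.sum, map_sum, inner_conj_symm]
    rw [Finset.sum_comm]
    refine Finset.sum_congr rfl fun a _ => Finset.sum_congr rfl fun b _ => ?_
    rw [← ContinuousLinearMap.adjoint_inner_right, ← ContinuousLinearMap.star_eq_adjoint,
      ← hφ.map_star, star_mul, star_star]
  re_inner_nonneg f := by
    -- Complete positivity concerns matrices indexed by `Fin n`, so the support of `f` has to be
    -- enumerated.
    let e := f.support.equivFin.symm
    have h := hφ.sum_inner_nonneg (fun i => (e i : A)) (fun i => f (e i))
    have h' : ∑ i, ∑ j, ⟪f (e i), φ (star (e i : A) * (e j : A)) (f (e j))⟫_ℂ =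
        f.sum fun a h => f.sum fun b k => ⟪h, φ (star a * b) k⟫_ℂ := by
      rw [Equiv.sum_comp e fun a => ∑ j, ⟪f a, φ (star (a : A) * (e j : A)) (f (e j))⟫_ℂ]
      simp only [fun a : f.support => Equiv.sum_comp e
        fun b => ⟪f a, φ (star (a : A) * (b : A)) (f b)⟫_ℂ]
      rw [Finset.sum_coe_sort f.support fun a => ∑ b : f.support,
        ⟪f a, φ (star (a : A) * (b : A)) (f b)⟫_ℂ]
      simp only [fun a : A => Finset.sum_coe_sort f.support
        fun b => ⟪f a, φ (star (a : A) * (b : A)) (f b)⟫_ℂ]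
      rfl
    rw [h'] at h
    exact (RCLike.nonneg_iff.mp h).1
  add_left f f' g := Finsupp.sum_add_index' (by simp)
    (by simp [Finsupp.sum, Finset.sum_add_distrib])
  smul_left f g r := by
    change (r • f).sum _ = _
    rw [Finsupp.sum_smul_index' (by simp)]
    simp only [inner_smul_left, Finsupp.sum, Finset.mul_sum]

theorem stinespringCore_inner {φ : A →ₗ[ℂ] (H →L[ℂ] H)} (hφ : IsCP φ) (f g : A →₀ H) :
    (stinespringCore hφ).inner f g = f.sum fun a h => g.sum fun b k => ⟪h, φ (star a * b) k⟫_ℂ :=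
  rfl

/-- The Stinespring dilation of a unital completely positive map. -/
theorem IsUCP.exists_dilation {φ : A →ₗ[ℂ] (H →L[ℂ] H)} (hφ : IsUCP φ) :
    ∃ (K : Type u) (_ : NormedAddCommGroup K) (_ : InnerProductSpace ℂ K) (_ : CompleteSpace K)
      (V : H →ₗᵢ[ℂ] K) (π : A →⋆ₐ[ℂ] (K →L[ℂ] K)),
        ∀ a, (ContinuousLinearMap.adjoint V.toContinuousLinearMap) ∘L π a ∘L
          V.toContinuousLinearMap = φ a := by
  -- `A →₀ H` replaces the tensor product: `single a h` stands for `a ⊗ h`. It is not additive in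
  -- `a`, but the defect is null for the form, which is why `exists_representation` asks for
  -- linearity only in inner products.
  obtain ⟨K, i₁, i₂, i₃, j, π, -, hj, hπ⟩ := exists_representation (stinespringCore hφ.1)
    (fun c => Finsupp.lmapDomain H ℂ (c * ·)) (fun m => by simp [show (fun x : A => x) = id from rfl])
    (fun a b m => by simp [← Finsupp.mapDomain_comp, Function.comp_def, mul_assoc])
    (fun a m m' => by
      simp only [stinespringCore_inner, Finsupp.lmapDomain_apply]
      rw [Finsupp.sum_mapDomain_index (by simp) (by simp)]
      refine Finsupp.sum_congr fun c _ => ?_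
      rw [Finsupp.sum_mapDomain_index (by simp) (by simp)]
      simp only [star_mul, mul_assoc])
    (fun a b m m' => by
      simp only [stinespringCore_inner, Finsupp.lmapDomain_apply]
      rw [← Finsupp.sum_add]
      refine Finsupp.sum_congr fun c _ => ?_
      rw [Finsupp.sum_mapDomain_index (by simp) (by simp),
        Finsupp.sum_mapDomain_index (by simp) (by simp),
        Finsupp.sum_mapDomain_index (by simp) (by simp), ← Finsupp.sum_add]
      simp only [add_mul, mul_add, map_add, add_apply, inner_add_right])
    (fun z a m m' => by
      simp only [stinespringCore_inner, Finsupp.lmapDomain_apply]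
      simp only [fun b c h => Finsupp.sum_mapDomain_index (f := (b * · : A → A)) (s := m')
        (h := fun b k => ⟪h, φ (star c * b) k⟫_ℂ) (by simp) (by simp)]
      simp [Finsupp.sum, Finset.mul_sum])
  have h1 : φ 1 = 1 := hφ.2
  -- The embedding `h ↦ 1 ⊗ h` is isometric because `φ 1 = 1`.
  let V : H →ₗᵢ[ℂ] K := (j ∘ₗ Finsupp.lsingle 1).isometryOfInner fun h k => by
    simp [hj, stinespringCore_inner, h1]
  have hV : ∀ h, V h = j (Finsupp.single 1 h) := fun _ => rfl
  refine ⟨K, i₁, i₂, i₃, V, π, fun a => ?_⟩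
  ext h
  refine ext_inner_left ℂ fun k => ?_
  simp only [ContinuousLinearMap.comp_apply, ContinuousLinearMap.adjoint_inner_right]
  change ⟪V k, π a (V h)⟫_ℂ = _
  rw [hV, hV, hπ, hj]
  simp [stinespringCore_inner]

/-- A maximal ucp map on a C*-algebra is a `*`-representation. -/
theorem IsMaximalUCP.exists_starAlgHom {φ : A →ₗ[ℂ] (H →L[ℂ] H)} (hφ : IsMaximalUCP φ) :
    ∃ π : A →⋆ₐ[ℂ] (H →L[ℂ] H), φ = (π : A →ₗ[ℂ] (H →L[ℂ] H)) := by
  obtain ⟨K, _, _, _, V, ρ, hV⟩ := hφ.1.exists_dilation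
  have hcomm := hφ.2 K V ρ ρ.isUCP hV
  have hV' : ∀ a h, ContinuousLinearMap.adjoint V.toContinuousLinearMap (ρ a (V h)) = φ a h :=
    fun a h => congrArg (fun T : H →L[ℂ] H => T h) (hV a)
  have hVV : ∀ h, ContinuousLinearMap.adjoint V.toContinuousLinearMap (V h) = h := fun h => by
    have := hV' 1 h
    have h1 : φ 1 = 1 := hφ.1.2
    rwa [map_one, h1] at this
  have h1 : φ 1 = 1 := hφ.1.2
  -- As `V V*` commutes with `ρ(b)` and `V* V = 1`, we get `V* ρ(a) V V* ρ(b) V = V* ρ(a) ρ(b) V`.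
  have hmul : ∀ a b, φ (a * b) = φ a * φ b := by
    intro a b
    ext h
    have hc : ∀ k, V (ContinuousLinearMap.adjoint V.toContinuousLinearMap (ρ b k)) =
        ρ b (V (ContinuousLinearMap.adjoint V.toContinuousLinearMap k)) :=
      fun k => congrArg (fun T : K →L[ℂ] K => T k) (hcomm b)
    rw [mul_apply_eq_comp, ← hV', ← hV', ← hV', hc, hVV, map_mul, mul_apply_eq_comp]
  exact ⟨{ φ with
    map_one' := h1
    map_mul' := hmul
    map_zero' := map_zero φ
    commutes' := fun z => by
      simp [Algebra.algebraMap_eq_smul_one, h1]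
    map_star' := hφ.1.1.map_star }, rfl⟩

/-- The spectrum of a positive element is compact in `[0, ∞)`, so avoiding `0` means being bounded
away from it. This translates the constant `g` of hermitian forms into invertibility; the zero
algebra is treated apart because its spectra are empty. -/
theorem exists_pos_algebraMap_le_iff_isUnit {a : A} (ha : 0 ≤ a) :
    (∃ g : ℝ, 0 < g ∧ algebraMap ℝ A g ≤ a) ↔ IsUnit a := by
  rcases subsingleton_or_nontrivial A with hA | hA
  · exact ⟨fun _ => isUnit_of_subsingleton a, fun _ => ⟨1, one_pos, (Subsingleton.elim _ _).le⟩⟩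
  · have h := CFC.exists_pos_algebraMap_le_iff (IsSelfAdjoint.of_nonneg ha)
    have h' := StarOrderedRing.isStrictlyPositive_iff_spectrum_pos (R := ℝ) a (.of_nonneg ha)
    rw [← h'] at h
    exact h.trans ⟨fun h => h.isUnit, fun h => h.isStrictlyPositive ha⟩

/-- An invertible self-adjoint matrix over a C*-algebra is a hermitian form. -/
theorem isHermForm_of_isUnit {n : ℕ} {x : Matrix (Fin n) (Fin n) A} (hx : x.IsHermitian)
    (hu : IsUnit (CFC.abs (toMatAlg x))) : IsHermForm x := by
  refine ⟨hx, ?_⟩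
  obtain ⟨g, hg, hgx⟩ := (exists_pos_algebraMap_le_iff_isUnit (CFC.abs_nonneg _)).mpr hu
  refine ⟨g, hg, fun K _ _ _ φ _ hφ => ?_⟩
  obtain ⟨π, rfl⟩ := hφ.exists_starAlgHom
  -- Entrywise application of `π` is a `*`-homomorphism, so it carries `g ≤ |x|` to `g ≤ |π(x)|`.
  have h := (matAlgMap n π).map_nonneg_of_nonneg (sub_nonneg.mpr hgx)
  rw [map_sub, StarAlgHom.map_abs, sub_nonneg, matAlgMap_toMatAlg] at h
  refine le_trans (le_of_eq ?_) h
  rw [Algebra.algebraMap_eq_smul_one, Algebra.algebraMap_eq_smul_one]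
  exact (((matAlgMap n π).toLinearMap.map_smul (g : ℂ) 1).trans
    (congrArg ((g : ℂ) • ·) (map_one (matAlgMap n π)))).symm

end Stinespring

/-! ### States and pure states vanishing at a singular positive element -/

section States

variable {B : Type u} [CStarAlgebra B] [PartialOrder B] [StarOrderedRing B]

/-- A singular positive element `y` is annihilated by a state. -/
theorem exists_state_eq_zero_of_not_isUnit {y : B} (hy : 0 ≤ y) (hu : ¬ IsUnit y) :
    ∃ ω : B →L[ℂ] ℂ, (∀ a, 0 ≤ a → 0 ≤ ω a) ∧ ω 1 = 1 ∧ ω y = 0 := by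
  -- An open convex cone of elements with strictly positive real part. Singularity of `y` says that
  -- `y ∉ s`, so Hahn–Banach separates them.
  let s : Set B := {a | ∃ ε : ℝ, 0 < ε ∧ algebraMap ℝ B ε ≤ (realPart a : B)}
  have hsc : Convex ℝ s := by
    rintro a ⟨ε, hε, ha⟩ b ⟨δ, hδ, hb⟩ t r ht hr htr
    refine ⟨t * ε + r * δ, ?_, ?_⟩
    · rcases ht.eq_or_lt with rfl | ht
      · have : r = 1 := by linarith
        subst this; linarith
      · have := mul_pos ht hε
        have := mul_nonneg hr hδ.le
        linarith
    · rw [map_add, map_add, map_mul, map_mul, ← Algebra.smul_def, ← Algebra.smul_def, map_smul,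
        map_smul]
      exact add_le_add (smul_le_smul_of_nonneg_left ha ht) (smul_le_smul_of_nonneg_left hb hr)
  have hso : IsOpen s := by
    rw [Metric.isOpen_iff]
    rintro a ⟨ε, hε, ha⟩
    refine ⟨ε / 2, by positivity, fun b hb => ⟨ε / 2, by positivity, ?_⟩⟩
    have h1 : ‖(realPart (b - a) : B)‖ ≤ ε / 2 := by
      refine (realPart.norm_le (b - a)).trans ?_
      rw [← dist_eq_norm]
      exact (Metric.mem_ball.mp hb).le
    have h2 : -algebraMap ℝ B (ε / 2) ≤ (realPart (b - a) : B) :=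
      (neg_le_neg (algebraMap_le_algebraMap_real h1)).trans
        (IsSelfAdjoint.neg_algebraMap_norm_le_self (realPart (b - a)).2)
    rw [map_sub, AddSubgroupClass.coe_sub, le_sub_iff_add_le] at h2
    refine le_trans ?_ h2
    rw [← sub_nonneg] at ha ⊢
    convert! ha using 1
    have : algebraMap ℝ B ε = algebraMap ℝ B (ε / 2) + algebraMap ℝ B (ε / 2) := by
      rw [← map_add, add_halves]
    rw [this]; abel
  have hre : ∀ a : B, IsSelfAdjoint a → (realPart a : B) = a := fun a ha => ha.coe_realPart
  have hys : y ∉ s := by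
    rintro ⟨ε, hε, h⟩
    rw [hre y (.of_nonneg hy)] at h
    exact hu ((exists_pos_algebraMap_le_iff_isUnit hy).mp ⟨ε, hε, h⟩)
  obtain ⟨f, hf⟩ := RCLike.geometric_hahn_banach_open_point (𝕜 := ℂ) hsc hso hys
  simp only [RCLike.re_eq_complex_re] at hf
  have h1 : (f 1).re < (f y).re := hf 1 ⟨1, one_pos, by rw [hre 1 (.one B), map_one]⟩
  have hsmul : ∀ a ∈ s, ∀ t : ℝ, 0 < t → t * (f a).re < (f y).re := by
    rintro a ⟨ε, hε, ha⟩ t ht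
    have := hf ((t : ℂ) • a) ⟨t * ε, by positivity, by
      rw [Complex.coe_smul, map_smul, map_mul, ← Algebra.smul_def]
      exact smul_le_smul_of_nonneg_left ha ht.le⟩
    simpa using this
  -- On a cone a real functional that is bounded above is nonpositive.
  have hs_nonpos : ∀ a ∈ s, (f a).re ≤ 0 := by
    intro a ha
    by_contra! h
    have := hsmul a ha ((|(f y).re| + 1) / (f a).re) (by positivity)
    rw [div_mul_cancel₀ _ h.ne'] at this
    linarith [le_abs_self (f y).re]
  have hs_add : ∀ a, 0 ≤ a → ∀ ε : ℝ, 0 < ε → a + (ε : ℂ) • 1 ∈ s := by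
    intro a ha ε hε
    refine ⟨ε, hε, ?_⟩
    have h2 : IsSelfAdjoint (a + (ε : ℂ) • 1) := by
      rw [Complex.coe_smul]
      exact (IsSelfAdjoint.of_nonneg ha).add (.smul (.all ε) (.one B))
    rw [hre _ h2, Complex.coe_smul, ← Algebra.algebraMap_eq_smul_one]
    exact le_add_of_nonneg_left ha
  have hnonpos : ∀ a, 0 ≤ a → (f a).re ≤ 0 := by
    intro a ha
    by_contra! h
    -- The perturbation `ε` is chosen so that `ε |Re f(1)| ≤ Re f(a) / 2`, too small to cancel a
    -- positive `Re f(a)`.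
    have h2 := hs_nonpos _ (hs_add a ha ((f a).re / (2 * (|(f 1).re| + 1))) (by positivity))
    simp only [map_add, map_smul, smul_eq_mul, Complex.add_re, Complex.re_ofReal_mul] at h2
    have h3 : |(f a).re / (2 * (|(f 1).re| + 1)) * (f 1).re| ≤ (f a).re / 2 := by
      rw [abs_mul, abs_of_pos (by positivity), div_mul_eq_mul_div, div_le_div_iff₀ (by positivity)
        (by positivity)]
      nlinarith [abs_nonneg (f 1).re]
    linarith [neg_abs_le ((f a).re / (2 * (|(f 1).re| + 1)) * (f 1).re)]
  have h1' : (f 1).re < 0 := h1.trans_le (hnonpos y hy)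
  have hy0 : (f y).re = 0 := by
    refine le_antisymm (hnonpos y hy) ?_
    by_contra! h
    -- A negative `Re f(y)` would be attained at the positive multiple of `1` by this factor,
    -- against strict separation.
    have := hsmul 1 ⟨1, one_pos, by rw [hre 1 (.one B), map_one]⟩ ((f y).re / (f 1).re)
      (div_pos_of_neg_of_neg h h1')
    rw [div_mul_cancel₀ _ h1'.ne] at this
    exact lt_irrefl _ this
  have him : ∀ a, IsSelfAdjoint a → (f a).im = 0 := by
    intro a ha
    by_contra h
    -- Adding a real multiple of `i a` leaves the real part equal to `1`, so the point stays in `s`;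
    -- this multiple makes `Re f` vanish there, although `Re f < Re f(y) = 0` on `s`.
    have := hf (1 + (((f 1).re / (f a).im : ℝ) : ℂ) • Complex.I • a) ⟨1, one_pos, by
      rw [Complex.coe_smul, map_add, map_smul, realPart_I_smul, ha.imaginaryPart, neg_zero,
        smul_zero, add_zero, hre 1 (.one B), map_one]⟩
    simp only [map_add, map_smul, smul_eq_mul, Complex.add_re, Complex.re_ofReal_mul,
      Complex.I_mul_re, hy0] at this
    rw [mul_neg, div_mul_cancel₀ _ h] at this
    linarith
  have hreal : ∀ a, IsSelfAdjoint a → f a = ((f a).re : ℂ) := fun a ha =>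
    Complex.ext (by simp) (by simp [him a ha])
  have h10 : f 1 ≠ 0 := fun h => by simp [h] at h1'
  -- `f` is nonpositive on positive elements and `f 1 < 0`, so the normalization restores
  -- positivity.
  refine ⟨(f 1)⁻¹ • f, fun a ha => ?_, ?_, ?_⟩
  · rw [smul_apply, smul_eq_mul, hreal a (.of_nonneg ha), hreal 1 (.one B), ← Complex.ofReal_inv,
      ← Complex.ofReal_mul, Complex.zero_le_real]
    exact mul_nonneg_of_nonpos_of_nonpos (inv_nonpos.mpr h1'.le) (hnonpos a ha)
  · rw [smul_apply, smul_eq_mul, inv_mul_cancel₀ h10]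
  · rw [smul_apply, smul_eq_mul, hreal y (.of_nonneg hy), hy0, Complex.ofReal_zero, mul_zero]

/-- On self-adjoint `b` the bound follows from `-‖b‖ ≤ b ≤ ‖b‖`; splitting into real and imaginary
parts costs the factor `2`, which is harmless. The bound makes positive functionals continuous, sets
of states weak-* compact, and functionals vanishing at `1` zero. -/
theorem norm_le_of_nonneg {ω : B →ₗ[ℂ] ℂ} (hω : ∀ a, 0 ≤ a → 0 ≤ ω a) (a : B) :
    ‖ω a‖ ≤ 2 * ‖ω 1‖ * ‖a‖ := by
  have hsa : ∀ b : B, IsSelfAdjoint b → ‖ω b‖ ≤ ‖ω 1‖ * ‖b‖ := by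
    intro b hb
    have h1 : ∀ r : ℝ, ω (algebraMap ℝ B r) = r * ω 1 := fun r => by
      rw [Algebra.algebraMap_eq_smul_one, ← Complex.coe_smul, map_smul, smul_eq_mul]
    have h2 := hω _ (sub_nonneg.mpr hb.le_algebraMap_norm_self)
    have h3 := hω _ (neg_le_iff_add_nonneg'.mp hb.neg_algebraMap_norm_le_self)
    rw [map_sub, h1] at h2
    rw [map_add, h1] at h3
    have h4 := hω 1 zero_le_one
    have h5 : ω b = ((ω b).re : ℂ) := by
      refine Complex.ext (by simp) ?_
      have h6 := (Complex.le_def.mp h3).2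
      have h7 := (Complex.le_def.mp h4).2
      simp at h6 h7
      simpa [← h7] using h6.symm
    have h8 : ω 1 = ((ω 1).re : ℂ) := Complex.ext (by simp) (by simp [← (Complex.le_def.mp h4).2])
    have h9 : 0 ≤ (ω 1).re := (Complex.le_def.mp h4).1
    rw [h5, h8] at h2 h3 ⊢
    rw [← Complex.ofReal_mul, ← Complex.ofReal_sub, Complex.zero_le_real] at h2
    rw [← Complex.ofReal_mul, ← Complex.ofReal_add, Complex.zero_le_real] at h3
    rw [Complex.norm_real, Complex.norm_real, Real.norm_eq_abs, Real.norm_eq_abs, abs_of_nonneg h9,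
      abs_le]
    constructor <;> linarith
  have h1 : ω a = ω (realPart a : B) + Complex.I * ω (imaginaryPart a : B) := by
    conv_lhs => rw [← realPart_add_I_smul_imaginaryPart a]
    rw [map_add, map_smul, smul_eq_mul]
  have h2 := hsa _ (realPart a).2
  have h3 := hsa _ (imaginaryPart a).2
  have h4 : ‖(realPart a : B)‖ ≤ ‖a‖ := realPart.norm_le a
  have h5 : ‖(imaginaryPart a : B)‖ ≤ ‖a‖ := imaginaryPart.norm_le a
  rw [h1]
  refine (norm_add_le _ _).trans ?_
  rw [norm_mul, Complex.norm_I, one_mul]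
  nlinarith [norm_nonneg (ω 1), mul_le_mul_of_nonneg_left h4 (norm_nonneg (ω 1)),
    mul_le_mul_of_nonneg_left h5 (norm_nonneg (ω 1))]

/-- A singular positive element `y` is annihilated by a pure state. -/
theorem exists_pure_state_eq_zero {y : B} (hy : 0 ≤ y) (hu : ¬ IsUnit y) :
    ∃ ω : B →ₗ[ℂ] ℂ, (∀ a, 0 ≤ a → 0 ≤ ω a) ∧ ω 1 = 1 ∧ ω y = 0 ∧
      ∀ τ : B →ₗ[ℂ] ℂ, (∀ a, 0 ≤ a → 0 ≤ τ a) → (∀ a, 0 ≤ a → τ a ≤ ω a) → τ = τ 1 • ω := by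
  -- `F` is a face of the state space: positive functionals below `ω ∈ F` also vanish at `y`. Hence
  -- its extreme points are pure states.
  let F : Set (WeakDual ℂ B) := {ω | (∀ a, 0 ≤ a → 0 ≤ ω a) ∧ ω 1 = 1 ∧ ω y = 0}
  have hF : IsCompact F := by
    refine WeakDual.isCompact_of_bounded_of_closed ?_ ?_
    · refine (Metric.isBounded_closedBall (x := (0 : StrongDual ℂ B)) (r := 2)).subset ?_
      intro ω hω
      rw [mem_closedBall_zero_iff]
      refine ContinuousLinearMap.opNorm_le_bound _ (by norm_num) fun a => ?_
      have := norm_le_of_nonneg (ω := (WeakDual.toStrongDual (ω : WeakDual ℂ B)).toLinearMap) hω.1 a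
      have h1 : (WeakDual.toStrongDual (ω : WeakDual ℂ B)).toLinearMap 1 = 1 := hω.2.1
      rw [h1, norm_one, mul_one] at this
      exact this
    · have hev : ∀ a : B, Continuous fun ω : WeakDual ℂ B => ω a := WeakDual.eval_continuous
      have : F = (⋂ (a : B) (_ : 0 ≤ a), {ω : WeakDual ℂ B | 0 ≤ ω a}) ∩
          ({ω | ω 1 = 1} ∩ {ω | ω y = 0}) := by
        ext ω; simp [F]
      rw [this]
      refine IsClosed.inter (isClosed_iInter fun a => isClosed_iInter fun _ => ?_)
        (IsClosed.inter ?_ ?_)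
      · exact isClosed_le continuous_const (hev a)
      · exact isClosed_eq (hev 1) continuous_const
      · exact isClosed_eq (hev y) continuous_const
  have : LocallyConvexSpace ℝ (WeakDual ℂ B) :=
    WeakBilin.locallyConvexSpace (B := topDualPairing ℂ B)
  obtain ⟨ω₀, hω₀⟩ := exists_state_eq_zero_of_not_isUnit hy hu
  obtain ⟨ω, ⟨hω, hω1, hωy⟩, hext⟩ := hF.extremePoints_nonempty ⟨StrongDual.toWeakDual ω₀, hω₀⟩
  let toW : ∀ σ : B →ₗ[ℂ] ℂ, (∀ a, 0 ≤ a → 0 ≤ σ a) → WeakDual ℂ B := fun σ hσ =>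
    StrongDual.toWeakDual (σ.mkContinuous (2 * ‖σ 1‖) (norm_le_of_nonneg hσ))
  have eq_zero : ∀ σ : B →ₗ[ℂ] ℂ, (∀ a, 0 ≤ a → 0 ≤ σ a) → σ 1 = 0 → σ = 0 := by
    intro σ hσ h
    ext a
    have := norm_le_of_nonneg hσ a
    rw [h, norm_zero, mul_zero, zero_mul] at this
    exact norm_le_zero_iff.mp this
  let ω' : B →ₗ[ℂ] ℂ := (WeakDual.toStrongDual ω).toLinearMap
  refine ⟨ω', hω, hω1, hωy, fun τ hτ hτω => ?_⟩
  have hω1' : ω' 1 = 1 := hω1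
  have hτω' : ∀ a, 0 ≤ a → 0 ≤ (ω' - τ) a := fun a ha => sub_nonneg.mpr (hτω a ha)
  have hτy : τ y = 0 := le_antisymm ((hτω y hy).trans_eq hωy) (hτ y hy)
  have hτ1 : τ 1 = ((τ 1).re : ℂ) :=
    Complex.ext (by simp) (by simp [← (Complex.le_def.mp (hτ 1 zero_le_one)).2])
  have hc0 : 0 ≤ (τ 1).re := (Complex.le_def.mp (hτ 1 zero_le_one)).1
  have hc1 : (τ 1).re ≤ 1 := by
    have := (Complex.le_def.mp (hτω 1 zero_le_one)).1
    rwa [hω1', Complex.one_re] at this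
  -- For `τ 1 = 0` or `τ 1 = 1`, one of `τ` and `ω - τ` vanishes at `1` and is therefore zero;
  -- otherwise both can be normalized to states.
  rcases hc0.eq_or_lt with hc | hc
  · rw [← hc, Complex.ofReal_zero] at hτ1
    rw [hτ1, zero_smul, eq_zero τ hτ hτ1]
  rcases hc1.eq_or_lt with hc' | hc'
  · rw [hc', Complex.ofReal_one] at hτ1
    rw [hτ1, one_smul]
    exact (sub_eq_zero.mp (eq_zero _ hτω' (by rw [LinearMap.sub_apply, hω1', hτ1, sub_self]))).symm
  generalize (τ 1).re = c at *
  have hmem : ∀ (σ : B →ₗ[ℂ] ℂ) (hσ : ∀ a, 0 ≤ a → 0 ≤ σ a), σ 1 = 1 → σ y = 0 → toW σ hσ ∈ F :=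
    fun σ hσ h1 hy => ⟨hσ, h1, hy⟩
  have hpos : ∀ (σ : B →ₗ[ℂ] ℂ) (r : ℝ), 0 < r → (∀ a, 0 ≤ a → 0 ≤ σ a) →
      ∀ a, 0 ≤ a → 0 ≤ ((r⁻¹ : ℂ) • σ) a := fun σ r hr hσ a ha => by
    rw [LinearMap.smul_apply, smul_eq_mul, ← Complex.ofReal_inv]
    exact mul_nonneg (Complex.zero_le_real.mpr (inv_nonneg.mpr hr.le)) (hσ a ha)
  have hcC : (c : ℂ) ≠ 0 := Complex.ofReal_ne_zero.mpr hc.ne'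
  have hcC' : ((1 - c : ℝ) : ℂ) ≠ 0 := Complex.ofReal_ne_zero.mpr (sub_pos.mpr hc').ne'
  -- Extremality is applied to `ω = c (τ / c) + (1 - c) ((ω - τ) / (1 - c))`, with `c = τ 1`.
  have key := hext
    (hmem _ (hpos τ c hc hτ) (by simp [hτ1, hcC]) (by simp [hτy]))
    (hmem _ (hpos (ω' - τ) (1 - c) (sub_pos.mpr hc') hτω')
      (by
        rw [LinearMap.smul_apply, LinearMap.sub_apply, hω1', hτ1, smul_eq_mul,
          ← Complex.ofReal_one, ← Complex.ofReal_sub, inv_mul_cancel₀ hcC', Complex.ofReal_one])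
      (by
        have : ω' y = 0 := hωy
        rw [LinearMap.smul_apply, LinearMap.sub_apply, this, hτy, sub_zero, smul_zero]))
    ⟨c, 1 - c, hc, sub_pos.mpr hc', by ring, by
      refine DFunLike.ext _ _ fun a => ?_
      change c • ((c : ℂ)⁻¹ • τ a) + (1 - c) • (((1 - c : ℝ) : ℂ)⁻¹ • (ω' a - τ a)) = ω' a
      rw [← Complex.coe_smul, ← Complex.coe_smul, smul_smul, smul_smul, mul_inv_cancel₀ hcC,
        mul_inv_cancel₀ hcC', one_smul, one_smul]
      ring⟩
  ext a
  have h : (c : ℂ)⁻¹ • τ a = ω' a := congrArg (fun σ : WeakDual ℂ B => σ a) key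
  rw [hτ1, LinearMap.smul_apply, ← h, smul_smul, mul_inv_cancel₀ hcC, one_smul]

end States

/-! ### Pure representations from pure states of `M_n(A)`; hermitian forms are invertible -/

/-- The matrix `(uᵢ* vⱼ)`. -/
def gram {A : Type u} [CStarAlgebra A] {n : ℕ} (u v : Fin n → A) : Matrix (Fin n) (Fin n) A :=
  Matrix.of fun i j => star (u i) * v j

theorem gram_apply {A : Type u} [CStarAlgebra A] {n : ℕ} (u v : Fin n → A) (i j : Fin n) :
    gram u v i j = star (u i) * v j := rfl

section PureRepresentations

variable {A : Type u} [CStarAlgebra A] [PartialOrder A] [StarOrderedRing A]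

theorem map_star_of_nonneg {ω : A →ₗ[ℂ] ℂ} (hω : ∀ a, 0 ≤ a → 0 ≤ ω a) (a : A) :
    ω (star a) = star (ω a) :=
  map_star (PositiveLinearMap.mk₀ ω hω) a


/-- The semi-inner product on `A ^ n` given by a positive functional on `M_n(A)`. -/
@[reducible] noncomputable def matrixStateCore {n : ℕ} {ω : MatAlg n A →ₗ[ℂ] ℂ}
    (hω : ∀ a, 0 ≤ a → 0 ≤ ω a) :
    PreInnerProductSpace.Core ℂ (Fin n → A) where
  inner u v := ω (toMatAlg (gram u v))
  conj_inner_symm u v := by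
    change star (ω _) = _
    rw [← map_star_of_nonneg hω, ← map_star]
    congr 2
    ext i j
    simp [gram_apply, Matrix.star_apply]
  re_inner_nonneg u := (RCLike.nonneg_iff.mp (hω _ (gram_mem_cone u))).1
  add_left u v w := by
    rw [← map_add, ← map_add]
    congr 2
    ext i j
    simp [gram_apply, add_mul]
  smul_left u v z := by
    change _ = star z * _
    rw [← smul_eq_mul, ← map_smul, ← map_smul]
    congr 2
    ext i j
    simp [gram_apply]

theorem matrixStateCore_inner {n : ℕ} {ω : MatAlg n A →ₗ[ℂ] ℂ} (hω : ∀ a, 0 ≤ a → 0 ≤ ω a)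
    (u v : Fin n → A) : (matrixStateCore hω).inner u v = ω (toMatAlg (gram u v)) := rfl

/-- A positive functional `ω` on `M_n(A)` is `a ↦ ∑ ⟪ξᵢ, π(aᵢⱼ) ξⱼ⟫` for a representation `π` of `A`
and a cyclic tuple of vectors `ξ`. -/
theorem exists_representation_of_matrix_state {n : ℕ} {ω : MatAlg n A →ₗ[ℂ] ℂ}
    (hω : ∀ a, 0 ≤ a → 0 ≤ ω a) :
    ∃ (K : Type u) (_ : NormedAddCommGroup K) (_ : InnerProductSpace ℂ K) (_ : CompleteSpace K)
      (π : A →⋆ₐ[ℂ] (K →L[ℂ] K)) (ξ : Fin n → K),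
        DenseRange (fun u : Fin n → A => ∑ i, π (u i) (ξ i)) ∧
        ∀ a : Matrix (Fin n) (Fin n) A, ∑ i, ∑ j, ⟪ξ i, π (a i j) (ξ j)⟫_ℂ = ω (toMatAlg a) := by
  -- Using rows `A ^ n` in place of `M_n(A)` yields a representation of `A` itself. The vectors `ξᵢ`
  -- are the classes of the unit rows, and the formula for `ω` comes from writing `a` as the sum of
  -- the Gram matrices of `eᵢ` and `aᵢⱼ eⱼ`.
  obtain ⟨K, i₁, i₂, i₃, J, π, hJ, hinner, hπ⟩ := exists_representation (matrixStateCore hω)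
    (fun a =>
      { toFun := fun u i => a * u i
        map_add' := fun u v => funext fun i => mul_add _ _ _
        map_smul' := fun z u => funext fun i => mul_smul_comm _ _ _ })
    (fun u => funext fun i => one_mul _) (fun a b u => funext fun i => mul_assoc _ _ _)
    (fun a u v => by
      rw [matrixStateCore_inner, matrixStateCore_inner]
      congr 2
      ext i j
      simp [gram_apply, mul_assoc])
    (fun a b u v => by
      simp only [matrixStateCore_inner]
      rw [← map_add, ← map_add]
      congr 2
      ext i j
      simp [gram_apply, add_mul, mul_add])
    (fun z a u v => by
      simp only [matrixStateCore_inner]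
      rw [← smul_eq_mul, ← map_smul, ← map_smul]
      congr 2
      ext i j
      simp [gram_apply])
  have hsingle : ∀ (a : A) (i : Fin n), π a (J (Pi.single i 1)) = J (Pi.single i a) := by
    intro a i
    rw [hπ]
    congr 1
    ext k
    by_cases hk : k = i
    · subst hk; simp
    · simp [hk]
  refine ⟨K, i₁, i₂, i₃, π, fun i => J (Pi.single i 1), ?_, fun a => ?_⟩
  · convert! hJ using 1
    ext u
    simp only [hsingle]
    rw [← map_sum]
    congr 1
    exact Finset.univ_sum_single u
  · simp only [hsingle, hinner, matrixStateCore_inner]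
    simp only [← map_sum]
    congr 2
    conv_rhs => rw [Matrix.matrix_eq_sum_single a]
    refine Finset.sum_congr rfl fun i _ => Finset.sum_congr rfl fun j _ => ?_
    ext k l
    rw [gram_apply, Matrix.single_apply, Pi.single_apply, Pi.single_apply]
    by_cases hk : i = k <;> by_cases hl : j = l <;> simp [hk, hl, eq_comm (a := k), eq_comm (a := l)]

/-- Since `T` commutes with `π`, the operator `π(uᵢ)*` moves past it. An operator in the commutant
is thus determined on a cyclic tuple by a functional on `M_n(A)`. -/
theorem inner_sum_apply {A : Type u} [CStarAlgebra A] {n : ℕ} {K : Type u} [NormedAddCommGroup K] [InnerProductSpace ℂ K]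
    [CompleteSpace K] (π : A →⋆ₐ[ℂ] (K →L[ℂ] K)) (ξ : Fin n → K) (T : K →L[ℂ] K)
    (hT : ∀ a, T * π a = π a * T) (u v : Fin n → A) :
    ⟪∑ i, π (u i) (ξ i), T (∑ j, π (v j) (ξ j))⟫_ℂ =
      ∑ i, ∑ j, ⟪ξ i, (T * π (gram u v i j)) (ξ j)⟫_ℂ := by
  simp only [map_sum, sum_inner, inner_sum, gram_apply, map_mul, map_star]
  rw [Finset.sum_comm]
  refine Finset.sum_congr rfl fun i _ => Finset.sum_congr rfl fun j _ => ?_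
  rw [← mul_assoc, ← map_star, hT, map_star, mul_assoc, mul_apply_eq_comp,
    ContinuousLinearMap.star_eq_adjoint, ContinuousLinearMap.adjoint_inner_right]
  rfl

/-- The representation of a pure state of `M_n(A)` is a pure map. -/
theorem isPureCP_of_pure_state {n : ℕ} {ω : MatAlg n A →ₗ[ℂ] ℂ} (hω1 : ω 1 = 1)
    (hpure : ∀ τ : MatAlg n A →ₗ[ℂ] ℂ, (∀ a, 0 ≤ a → 0 ≤ τ a) → (∀ a, 0 ≤ a → τ a ≤ ω a) →
      τ = τ 1 • ω)
    {K : Type u} [NormedAddCommGroup K] [InnerProductSpace ℂ K] [CompleteSpace K]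
    {π : A →⋆ₐ[ℂ] (K →L[ℂ] K)} {ξ : Fin n → K}
    (hξ : DenseRange (fun u : Fin n → A => ∑ i, π (u i) (ξ i)))
    (hπ : ∀ a : Matrix (Fin n) (Fin n) A, ∑ i, ∑ j, ⟪ξ i, π (a i j) (ξ j)⟫_ℂ = ω (toMatAlg a)) :
    IsPureCP (π : A →ₗ[ℂ] (K →L[ℂ] K)) := by
  refine ⟨π.isCP, fun h0 => ?_, fun ψ hψ hπψ => ?_⟩
  · have h : ∀ a, π a = 0 := fun a => congrArg (fun φ : A →ₗ[ℂ] (K →L[ℂ] K) => φ a) h0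
    have := hπ 1
    rw [map_one, hω1] at this
    simp [h] at this
  -- The functional which `ψ` and `ξ` define on `M_n(A)` lies below `ω`, so purity of `ω` makes it a
  -- multiple of `ω`.
  · let τ : MatAlg n A →ₗ[ℂ] ℂ :=
      { toFun := fun a => ∑ i, ∑ j, ⟪ξ i, ψ (toMatAlg.symm a i j) (ξ j)⟫_ℂ
        map_add' := fun a b => by
          simp [Finset.sum_add_distrib]
        map_smul' := fun z a => by
          simp [Finset.mul_sum] }
    have hτ : ∀ a, τ (toMatAlg a) = ∑ i, ∑ j, ⟪ξ i, ψ (a i j) (ξ j)⟫_ℂ := fun _ => rfl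
    have hτ' := hpure τ
      (fun a ha => sum_inner_nonneg_of_mem_cone (hψ n (toMatAlg.symm a) ha) ξ)
      (fun a ha => by
        have h := sum_inner_nonneg_of_mem_cone (hπψ n (toMatAlg.symm a) ha) ξ
        have h' := hπ (toMatAlg.symm a)
        rw [← sub_nonneg]
        change _ = ω a at h'
        rw [← h']
        change 0 ≤ _ - ∑ i, ∑ j, ⟪ξ i, ψ (toMatAlg.symm a i j) (ξ j)⟫_ℂ
        refine h.trans_eq ?_
        rw [← Finset.sum_sub_distrib]
        refine Finset.sum_congr rfl fun i _ => ?_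
        rw [← Finset.sum_sub_distrib]
        exact Finset.sum_congr rfl fun j _ => inner_sub_right _ _ _)
    have hT := hψ.commute_of_dominated hπψ
    -- `ψ 1` lies in the commutant, so its coefficients on the dense cyclic subspace are values of
    -- `τ = τ 1 • ω`, those of a scalar operator.
    have hT1 : ψ 1 = τ 1 • 1 := by
      refine DFunLike.coe_injective (hξ.equalizer (ψ 1).continuous (τ 1 • 1 : K →L[ℂ] K).continuous
        (funext fun v => ?_))
      refine ext_inner_left ℂ fun k => hξ.induction_on k (isClosed_eq ?_ ?_) fun u => ?_
      · exact continuous_id.inner continuous_const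
      · exact continuous_id.inner continuous_const
      · have h1 := inner_sum_apply π ξ 1 (fun a => by rw [one_mul, mul_one]) u v
        simp only [one_mul, hπ] at h1
        simp only [Function.comp_apply]
        rw [inner_sum_apply π ξ (ψ 1) hT]
        simp only [← hψ.eq_mul_of_dominated hπψ]
        rw [one_apply_eq_self] at h1
        rw [← hτ, hτ', LinearMap.smul_apply, LinearMap.smul_apply, hω1, smul_eq_mul, smul_eq_mul,
          mul_one, smul_apply, one_apply_eq_self, inner_smul_right, h1]
    refine ⟨τ 1, LinearMap.ext fun b => ?_⟩
    rw [hψ.eq_mul_of_dominated hπψ b, hT1, smul_mul_assoc, one_mul]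
    rfl

/-- A hermitian form over a C*-algebra is invertible. -/
theorem IsHermForm.isUnit {n : ℕ} {x : Matrix (Fin n) (Fin n) A} (hx : IsHermForm x) :
    IsUnit (toMatAlg x) := by
  obtain ⟨hsa, g, hg, hgx⟩ := hx
  by_contra hu
  have hu' : ¬ IsUnit (toMatAlg (star x * x)) := fun h => hu <| by
    rw [Matrix.star_eq_conjTranspose, hsa, map_mul] at h
    exact isUnit_mul_self_iff.mp h
  obtain ⟨ω, hω, hω1, hω0, hpure⟩ := exists_pure_state_eq_zero
    (show 0 ≤ toMatAlg (star x * x) from toMatAlg_star_mul_self_nonneg x) hu'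
  obtain ⟨K, _, _, _, π, ξ, hξ, hπ⟩ := exists_representation_of_matrix_state hω
  -- The representation is pure and maximal, so the bound for `x` applies to it: `|π(x)|` is
  -- invertible, and `π(x)* π(x) = |π(x)|²` provides the left inverse `D` of `π(x)`.
  have habs := (exists_pos_algebraMap_le_iff_isUnit (CFC.abs_nonneg _)).mp
    ⟨g, hg, hgx K π (isPureCP_of_pure_state hω1 hpure hξ hπ) π.isMaximalUCP⟩
  have hsq := habs.mul habs
  rw [CFC.abs_mul_abs] at hsq
  obtain ⟨W, hW⟩ := hsq.exists_left_inv
  let D : Matrix (Fin n) (Fin n) (K →L[ℂ] K) := toMatAlg.symm W * star (x.map π)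
  have hD : D * x.map π = 1 := (mul_assoc _ _ _).trans hW
  -- `ω(x* x)` is the sum over the rows of `x` of the squared norms of these vectors, and it
  -- vanishes.
  have hker : ∀ k, ∑ j, π (x k j) (ξ j) = 0 := by
    have h1 : ∀ k, ((‖∑ j, π (x k j) (ξ j)‖ ^ 2 : ℝ) : ℂ) = ω (toMatAlg (gram (x k) (x k))) := by
      intro k
      have := inner_sum_apply π ξ 1 (fun a => by rw [one_mul, mul_one]) (x k) (x k)
      simp only [one_mul, hπ] at this
      rw [← this, one_apply_eq_self, inner_self_eq_norm_sq_to_K]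
      norm_cast
    have h2 : star x * x = ∑ k, gram (x k) (x k) := by
      ext i j
      simp [Matrix.mul_apply, Matrix.sum_apply, gram_apply, Matrix.star_apply]
    rw [h2, map_sum, map_sum] at hω0
    simp only [← h1, ← Complex.ofReal_sum, Complex.ofReal_eq_zero] at hω0
    rw [Finset.sum_eq_zero_iff_of_nonneg fun k _ => sq_nonneg _] at hω0
    exact fun k => norm_eq_zero.mp (pow_eq_zero_iff two_ne_zero |>.mp (hω0 k (Finset.mem_univ k)))
  have hξ0 : ∀ i, ξ i = 0 := by
    intro i
    have h1 : ∑ j, (D * x.map π) i j (ξ j) = ξ i := by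
      rw [hD, Finset.sum_eq_single i]
      · simp
      · intro j _ hj
        simp [Matrix.one_apply_ne hj.symm]
      · simp
    rw [← h1]
    simp only [Matrix.mul_apply, sum_apply, Matrix.map_apply, mul_apply_eq_comp]
    rw [Finset.sum_comm]
    refine Finset.sum_eq_zero fun k _ => ?_
    rw [← map_sum, hker, map_zero]
  -- With all `ξᵢ` zero, `ω 1` would be `0`.
  have := hπ 1
  rw [map_one, hω1] at this
  simp [hξ0] at this

end PureRepresentations

/-! ### Signs of invertible self-adjoint elements -/

section Signs

variable {B : Type u} [CStarAlgebra B] [PartialOrder B] [StarOrderedRing B]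

theorem isUnit_abs {x : B} (hx : IsSelfAdjoint x) (hu : IsUnit x) : IsUnit (CFC.abs x) := by
  rw [← isUnit_mul_self_iff, CFC.abs_mul_abs, hx]
  exact hu.mul hu

theorem isUnit_of_isUnit_abs {x : B} (hx : IsSelfAdjoint x) (hu : IsUnit (CFC.abs x)) :
    IsUnit x := by
  rw [← isUnit_mul_self_iff]
  nth_rewrite 1 [← hx.star_eq]
  rw [← CFC.abs_mul_abs]
  exact hu.mul hu

/-- The sign `x |x|⁻¹` of an invertible self-adjoint element. -/
noncomputable def cstarSign (x : B) : B := x * Ring.inverse (CFC.abs x)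

theorem commute_inverse_abs {x : B} (hx : IsSelfAdjoint x) :
    Commute x (Ring.inverse (CFC.abs x)) := by
  have h : Commute x (CFC.abs x) := Commute.symm (CFC.commute_abs_self x hx.isStarNormal)
  by_cases hu : IsUnit (CFC.abs x)
  · obtain ⟨v, hv⟩ := hu
    rw [← hv] at h ⊢
    rw [Ring.inverse_unit]
    exact h.units_inv_right
  -- `Ring.inverse` takes the value `0` at non-units, so commutation holds there too.
  · rw [Ring.inverse_non_unit _ hu]
    exact Commute.zero_right x

theorem isSelfAdjoint_inverse_abs (x : B) : IsSelfAdjoint (Ring.inverse (CFC.abs x)) := by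
  rw [IsSelfAdjoint, ← Ring.inverse_star, (IsSelfAdjoint.of_nonneg (CFC.abs_nonneg x)).star_eq]

theorem isSelfAdjoint_cstarSign {x : B} (hx : IsSelfAdjoint x) : IsSelfAdjoint (cstarSign x) := by
  rw [cstarSign, IsSelfAdjoint, star_mul, hx.star_eq, (isSelfAdjoint_inverse_abs x).star_eq]
  exact (commute_inverse_abs hx).symm

theorem cstarSign_mul_self {x : B} (hx : IsSelfAdjoint x) (hu : IsUnit (CFC.abs x)) :
    cstarSign x * cstarSign x = 1 := by
  have h : x * x = CFC.abs x * CFC.abs x := by rw [CFC.abs_mul_abs, hx.star_eq]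
  have hc := (commute_inverse_abs hx).eq
  unfold cstarSign
  calc x * Ring.inverse (CFC.abs x) * (x * Ring.inverse (CFC.abs x))
      = x * (Ring.inverse (CFC.abs x) * x) * Ring.inverse (CFC.abs x) := by simp only [mul_assoc]
    _ = (x * x) * (Ring.inverse (CFC.abs x) * Ring.inverse (CFC.abs x)) := by
      rw [← hc]; simp only [mul_assoc]
    _ = CFC.abs x * (CFC.abs x * Ring.inverse (CFC.abs x)) * Ring.inverse (CFC.abs x) := by
      rw [h]; simp only [mul_assoc]
    _ = 1 := by rw [Ring.mul_inverse_cancel _ hu, mul_one, Ring.mul_inverse_cancel _ hu]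

theorem isStarProjection_of_symmetry {B : Type u} [CStarAlgebra B] {s : B} (hs : IsSelfAdjoint s) (hs' : s * s = 1) :
    IsStarProjection ((1 / 2 : ℂ) • (1 - s)) := by
  rw [isStarProjection_iff']
  constructor
  · rw [smul_mul_smul_comm, sub_mul, mul_sub, mul_sub, hs', one_mul, mul_one, one_mul,
      show 1 - s - (s - 1) = (2 : ℂ) • (1 - s) by rw [two_smul]; abel, smul_smul]
    norm_num
  · rw [star_smul, star_sub, star_one, hs.star_eq]
    simp

theorem isSelfAdjoint_one_sub_two_smul {B : Type u} [CStarAlgebra B] {p : B} (hp : IsStarProjection p) :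
    IsSelfAdjoint (1 - (2 : ℂ) • p) := by
  rw [IsSelfAdjoint, star_sub, star_one, star_smul, hp.isSelfAdjoint.star_eq]
  simp

/-- `1 - 2p` is self-adjoint with square `1`. It therefore equals its own sign, so passing from
projections to forms and back is the identity on the nose. -/
theorem abs_one_sub_two_smul {p : B} (hp : IsStarProjection p) :
    CFC.abs (1 - (2 : ℂ) • p) = 1 := by
  refine CFC.sqrt_unique ?_ zero_le_one
  rw [(isSelfAdjoint_one_sub_two_smul hp).star_eq, mul_one, sub_mul, mul_sub, one_mul, one_mul,
    mul_sub, mul_one, smul_mul_smul_comm, hp.isIdempotentElem.eq]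
  rw [show (2 : ℂ) * 2 = 2 + 2 by norm_num, add_smul]
  simp

theorem continuous_abs_comp {T : Type*} [TopologicalSpace T] {f : T → B} (hf : Continuous f)
    (hsa : ∀ t, IsSelfAdjoint (f t)) : Continuous fun t => CFC.abs (f t) := by
  simp only [fun t => CFC.abs_eq_cfc_norm (f t) (hsa t)]
  -- The functional calculus is continuous while the spectra stay, locally in `t`, in one compact
  -- set: the ball at `t₀` contains those of all `f t` with `‖f t‖ < ‖f t₀‖ + 1`. The factor `‖1‖`
  -- covers the zero algebra.
  refine Continuous.cfc (s := fun t => Metric.closedBall 0 ((‖f t‖ + 1) * ‖(1 : B)‖)) _ hf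
    (fun t => isCompact_closedBall _ _) (fun t₀ => ?_) (fun t => by fun_prop) hsa
  have h : ∀ᶠ t in nhds t₀, ‖f t‖ < ‖f t₀‖ + 1 :=
    (hf.norm.tendsto t₀).eventually (gt_mem_nhds (lt_add_one _))
  filter_upwards [h] with t ht r hr
  rw [mem_closedBall_zero_iff]
  exact (spectrum.norm_le_norm_mul_of_mem hr).trans
    (mul_le_mul_of_nonneg_right ht.le (norm_nonneg _))

theorem continuous_cstarSign_comp {T : Type*} [TopologicalSpace T] {f : T → B} (hf : Continuous f)
    (hsa : ∀ t, IsSelfAdjoint (f t)) (hu : ∀ t, IsUnit (f t)) :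
    Continuous fun t => cstarSign (f t) := by
  refine hf.mul (continuous_iff_continuousAt.mpr fun t => ?_)
  obtain ⟨v, hv⟩ := isUnit_abs (hsa t) (hu t)
  have h := NormedRing.inverse_continuousAt v
  rw [hv] at h
  exact h.comp (f := fun t => CFC.abs (f t)) (continuous_abs_comp hf hsa).continuousAt

/-- The segment from `x` to its sign `x |x|⁻¹`. -/
noncomputable def signPath (x : B) (t : ℝ) : B :=
  x * ((1 - t) • 1 + t • Ring.inverse (CFC.abs x))

theorem isSelfAdjoint_signPath {x : B} (hx : IsSelfAdjoint x) (t : ℝ) :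
    IsSelfAdjoint (signPath x t) := by
  have h1 : IsSelfAdjoint ((1 - t) • 1 + t • Ring.inverse (CFC.abs x)) :=
    (IsSelfAdjoint.smul (.all _) (.one B)).add (.smul (.all _) (isSelfAdjoint_inverse_abs x))
  rw [signPath, IsSelfAdjoint, star_mul, hx.star_eq, h1.star_eq]
  exact (((Commute.one_right x).smul_right _).add_right
    ((commute_inverse_abs hx).smul_right t)).symm

/-- The second factor is a convex combination of `1` and `|x|⁻¹ ≥ g > 0`, hence at least `min 1 g`
and invertible. -/
theorem isUnit_signPath {x : B} (hx : IsSelfAdjoint x) (hu : IsUnit x) {t : ℝ}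
    (ht : t ∈ unitInterval) : IsUnit (signPath x t) := by
  have habs := isUnit_abs hx hu
  have hsp : IsStrictlyPositive (CFC.abs x) := habs.isStrictlyPositive (CFC.abs_nonneg x)
  have hinv := hsp.ringInverse
  obtain ⟨g, hg, hgx⟩ := (exists_pos_algebraMap_le_iff_isUnit hinv.nonneg).mpr hinv.isUnit
  refine hu.mul ((exists_pos_algebraMap_le_iff_isUnit ?_).mp ⟨min 1 g, by positivity, ?_⟩)
  · exact add_nonneg (smul_nonneg (sub_nonneg.mpr ht.2) zero_le_one)
      (smul_nonneg ht.1 hinv.nonneg)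
  · have h1 : algebraMap ℝ B (min 1 g) =
        (1 - t) • algebraMap ℝ B (min 1 g) + t • algebraMap ℝ B (min 1 g) := by
      rw [← add_smul]; simp
    rw [h1]
    refine add_le_add (smul_le_smul_of_nonneg_left ?_ (sub_nonneg.mpr ht.2))
      (smul_le_smul_of_nonneg_left ?_ ht.1)
    · exact (algebraMap_le_algebraMap_real (min_le_left 1 g)).trans_eq (map_one _)
    · exact (algebraMap_le_algebraMap_real (min_le_right 1 g)).trans hgx

theorem signPath_zero (x : B) : signPath x 0 = x := by simp [signPath]

theorem signPath_one (x : B) : signPath x 1 = cstarSign x := by simp [signPath, cstarSign]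

/-- Write `x = (ε + x) - ε` with `0 ≤ ε + x ≤ 2ε`. The constant `3` is crude, but only the topology
matters. -/
theorem norm_le_of_mem_Icc {x : B} {ε : ℝ} (hε : 0 ≤ ε) (h₁ : 0 ≤ algebraMap ℝ B ε + x)
    (h₂ : 0 ≤ algebraMap ℝ B ε - x) : ‖x‖ ≤ 3 * ε := by
  have hε' : 0 ≤ algebraMap ℝ B ε := by
    rw [← map_zero (algebraMap ℝ B)]; exact algebraMap_le_algebraMap_real hε
  have h3 := (CStarAlgebra.norm_le_iff_le_algebraMap _ hε hε').mpr le_rfl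
  have h4 := (CStarAlgebra.norm_le_iff_le_algebraMap _ (by positivity : 0 ≤ 2 * ε) h₁).mpr (by
    rw [two_mul, map_add]
    exact add_le_add_right (sub_nonneg.mp h₂) _)
  have h5 := norm_sub_le (algebraMap ℝ B ε + x) (algebraMap ℝ B ε)
  rw [add_sub_cancel_left] at h5
  linarith

end Signs

/-! ### Hermitian forms and projections as homotopy equivalent spaces -/

section HermFormTopology

variable {A : Type u} [CStarAlgebra A] [PartialOrder A] [StarOrderedRing A]

theorem isSelfAdjoint_toMatAlg {n : ℕ} {x : Matrix (Fin n) (Fin n) A} :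
    IsSelfAdjoint (toMatAlg x) ↔ x.IsHermitian := by
  rw [IsSelfAdjoint, ← map_star]
  exact toMatAlg.injective.eq_iff

theorem orderNormLE_iff {n : ℕ} {x : Matrix (Fin n) (Fin n) A} {ε : ℝ} :
    OrderNormLE x ε ↔ 0 ≤ algebraMap ℝ (MatAlg n A) ε + toMatAlg x ∧
      0 ≤ algebraMap ℝ (MatAlg n A) ε - toMatAlg x := by
  rw [← toMatAlg_smul_diagonal_one, ← map_add, ← map_sub]
  exact Iff.rfl

theorem orderNormLE_of_norm_le {n : ℕ} {x : Matrix (Fin n) (Fin n) A} (hx : x.IsHermitian) {ε : ℝ}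
    (h : ‖toMatAlg x‖ ≤ ε) : OrderNormLE x ε := by
  have hsa := isSelfAdjoint_toMatAlg.mpr hx
  have hε := algebraMap_le_algebraMap_real (B := MatAlg n A) h
  rw [orderNormLE_iff]
  constructor
  · exact neg_le_iff_add_nonneg'.mp ((neg_le_neg hε).trans hsa.neg_algebraMap_norm_le_self)
  · exact sub_nonneg.mpr (hsa.le_algebraMap_norm_self.trans hε)

/-- Order-norm balls of radius `ε / 4` lie in norm balls of radius `ε`, as `3 (ε / 4) < ε`. -/
theorem HermForm.continuous_toMatAlg_val (n : ℕ) :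
    Continuous fun x : HermForm A n => toMatAlg x.val := by
  refine continuous_def.mpr fun U hU x hx => ?_
  obtain ⟨ε, hε, h⟩ := Metric.isOpen_iff.mp hU _ hx
  refine ⟨ε / 4, by positivity, fun y hy => h ?_⟩
  rw [orderNormLE_iff] at hy
  rw [Metric.mem_ball, dist_eq_norm, ← map_sub]
  refine (norm_le_of_mem_Icc (by positivity) hy.1 hy.2).trans_lt ?_
  linarith

theorem HermForm.continuous_of_continuous_toMatAlg {T : Type*} [PseudoMetricSpace T] {n : ℕ}
    {f : T → HermForm A n} (hf : Continuous fun t => toMatAlg (f t).val) : Continuous f := by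
  refine continuous_of_orderNormLE fun t ε hε => ?_
  obtain ⟨δ, hδ, h⟩ := Metric.continuous_iff.mp hf t ε hε
  refine ⟨δ, hδ, fun s hs => orderNormLE_of_norm_le ((f s).property.1.sub (f t).property.1) ?_⟩
  rw [map_sub, ← dist_eq_norm]
  exact (h s hs).le

theorem HermForm.isSelfAdjoint {n : ℕ} (x : HermForm A n) : IsSelfAdjoint (toMatAlg x.val) :=
  isSelfAdjoint_toMatAlg.mpr x.property.1

theorem HermForm.isUnit_abs {n : ℕ} (x : HermForm A n) : IsUnit (CFC.abs (toMatAlg x.val)) :=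
  _root_.isUnit_abs x.isSelfAdjoint x.property.isUnit

/-- An invertible self-adjoint element of `M_n(A)`, as a hermitian form. -/
noncomputable def HermForm.ofMatAlg {n : ℕ} (x : MatAlg n A) (hx : IsSelfAdjoint x)
    (hu : IsUnit x) : HermForm A n :=
  ⟨toMatAlg.symm x, isHermForm_of_isUnit (isSelfAdjoint_toMatAlg.mp hx) (_root_.isUnit_abs hx hu)⟩

theorem HermForm.toMatAlg_val_ofMatAlg {n : ℕ} (x : MatAlg n A) (hx : IsSelfAdjoint x)
    (hu : IsUnit x) : toMatAlg (HermForm.ofMatAlg x hx hu).val = x := rfl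

/-- The projection `(1 - x |x|⁻¹) / 2` of a hermitian form `x`. -/
noncomputable def HermForm.toProj {n : ℕ} (x : HermForm A n) : Proj A n :=
  ⟨(1 / 2 : ℂ) • (1 - cstarSign (toMatAlg x.val)), isStarProjection_of_symmetry
    (isSelfAdjoint_cstarSign x.isSelfAdjoint) (cstarSign_mul_self x.isSelfAdjoint x.isUnit_abs)⟩

/-- The hermitian form `1 - 2p` of a projection `p`. -/
noncomputable def Proj.toHermForm {n : ℕ} (p : Proj A n) : HermForm A n :=
  .ofMatAlg (1 - (2 : ℂ) • p.1) (isSelfAdjoint_one_sub_two_smul p.2)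
    (isUnit_of_isUnit_abs (isSelfAdjoint_one_sub_two_smul p.2)
      (by rw [abs_one_sub_two_smul p.2]; exact isUnit_one))

theorem HermForm.continuous_toProj (n : ℕ) :
    Continuous (HermForm.toProj : HermForm A n → Proj A n) := by
  refine Continuous.subtype_mk ?_ _
  exact (continuous_const.sub (continuous_cstarSign_comp (HermForm.continuous_toMatAlg_val n)
    (fun x : HermForm A n => x.isSelfAdjoint) fun x => x.property.isUnit)).const_smul
      (1 / 2 : ℂ)

theorem Proj.continuous_toHermForm (n : ℕ) :
    Continuous (Proj.toHermForm : Proj A n → HermForm A n) :=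
  HermForm.continuous_of_continuous_toMatAlg
    (continuous_const.sub (continuous_subtype_val.const_smul (2 : ℂ)) :
      Continuous fun p : Proj A n => 1 - (2 : ℂ) • p.1)

theorem Proj.toProj_toHermForm {n : ℕ} (p : Proj A n) : p.toHermForm.toProj = p := by
  refine Subtype.ext ?_
  change (1 / 2 : ℂ) • (1 - cstarSign (1 - (2 : ℂ) • p.1)) = p.1
  rw [cstarSign, abs_one_sub_two_smul p.2, Ring.inverse_one, mul_one, sub_sub_cancel, smul_smul]
  norm_num

/-- Going to the projection and back replaces `x` by its sign, and `signPath` joins the two through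
invertible self-adjoint elements, which are hermitian forms. -/
theorem HermForm.joined_toHermForm_toProj {n : ℕ} (x : HermForm A n) :
    Joined x.toProj.toHermForm x := by
  let f : unitInterval → HermForm A n := fun t => .ofMatAlg (signPath (toMatAlg x.val) t)
    (isSelfAdjoint_signPath x.isSelfAdjoint t)
    (isUnit_signPath x.isSelfAdjoint x.property.isUnit t.2)
  have hf : Continuous f := HermForm.continuous_of_continuous_toMatAlg (by
    simp only [f, HermForm.toMatAlg_val_ofMatAlg, signPath]
    fun_prop)
  refine Joined.symm ⟨⟨⟨f, hf⟩, HermForm.ext' (toMatAlg.injective ?_),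
    HermForm.ext' (toMatAlg.injective ?_)⟩⟩
  · exact signPath_zero _
  · refine (signPath_one _).trans ?_
    change _ = 1 - (2 : ℂ) • ((1 / 2 : ℂ) • (1 - cstarSign (toMatAlg x.val)))
    rw [smul_smul]
    norm_num

theorem inverse_toMatAlg_matrixSum {n m : ℕ} {x : Matrix (Fin n) (Fin n) A}
    {y : Matrix (Fin m) (Fin m) A} (hx : IsUnit (toMatAlg x)) (hy : IsUnit (toMatAlg y)) :
    Ring.inverse (toMatAlg (matrixSum x y)) =
      toMatAlg (matrixSum (toMatAlg.symm (Ring.inverse (toMatAlg x)))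
        (toMatAlg.symm (Ring.inverse (toMatAlg y)))) := by
  have one : matrixSum (1 : Matrix (Fin n) (Fin n) A) (1 : Matrix (Fin m) (Fin m) A) = 1 := by
    rw [← Matrix.diagonal_one, ← Matrix.diagonal_one, matrixSum_diagonal, Matrix.diagonal_one]
  have h₁ : x * toMatAlg.symm (Ring.inverse (toMatAlg x)) = 1 := Ring.mul_inverse_cancel _ hx
  have h₂ : y * toMatAlg.symm (Ring.inverse (toMatAlg y)) = 1 := Ring.mul_inverse_cancel _ hy
  have h₁' : toMatAlg.symm (Ring.inverse (toMatAlg x)) * x = 1 := Ring.inverse_mul_cancel _ hx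
  have h₂' : toMatAlg.symm (Ring.inverse (toMatAlg y)) * y = 1 := Ring.inverse_mul_cancel _ hy
  refine Ring.inverse_unit ⟨_, _, ?_, ?_⟩
  · rw [← map_mul, ← matrixSum_mul, h₁, h₂, one, map_one]
  · rw [← map_mul, ← matrixSum_mul, h₁', h₂', one, map_one]

/-- Absolute values and inverses of block diagonal matrices are computed blockwise, so the sign is
too. -/
theorem HermForm.toProj_dsum {n m : ℕ} (x : HermForm A n) (y : HermForm A m) :
    ((hermSystem A).dsum x y).toProj = (projSystem A).dsum x.toProj y.toProj := by
  refine Subtype.ext ?_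
  change (1 / 2 : ℂ) • (1 - cstarSign (toMatAlg (matrixSum x.val y.val))) =
    toMatAlg (matrixSum
      ((1 / 2 : ℂ) • (1 - x.val * toMatAlg.symm (Ring.inverse (CFC.abs (toMatAlg x.val)))))
      ((1 / 2 : ℂ) • (1 - y.val * toMatAlg.symm (Ring.inverse (CFC.abs (toMatAlg y.val))))))
  have one : matrixSum (1 : Matrix (Fin n) (Fin n) A) (1 : Matrix (Fin m) (Fin m) A) = 1 := by
    rw [← Matrix.diagonal_one, ← Matrix.diagonal_one, matrixSum_diagonal, Matrix.diagonal_one]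
  rw [cstarSign, abs_toMatAlg_matrixSum, inverse_toMatAlg_matrixSum
    (x := toMatAlg.symm (CFC.abs (toMatAlg x.val))) (y := toMatAlg.symm (CFC.abs (toMatAlg y.val)))
    x.isUnit_abs y.isUnit_abs,
    matrixSum_smul, matrixSum_sub, matrixSum_mul, one, map_smul, map_sub, map_one, map_mul]
  rfl

/-- The sign of a unit is `1`, so stabilizing forms by units matches stabilizing projections by
zeros. -/
theorem HermForm.toProj_base (n : ℕ) :
    ((hermSystem A).base n).toProj = (projSystem A).base n := by
  refine Subtype.ext ?_
  change (1 / 2 : ℂ) • (1 - cstarSign (toMatAlg (Matrix.diagonal fun _ => 1))) = (0 : MatAlg n A)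
  rw [Matrix.diagonal_one, map_one, cstarSign, CFC.abs_one, Ring.inverse_one, mul_one, sub_self,
    smul_zero]

end HermFormTopology

/-! ### Isomorphisms of stable homotopy classes -/

namespace SumSystem

variable {X Y : ℕ → Type u} [∀ n, TopologicalSpace (X n)] [∀ n, TopologicalSpace (Y n)]
  {S : SumSystem X} {T : SumSystem Y}

theorem Homotopic.map {F : ∀ n, X n → Y n} (hF : ∀ n, Continuous (F n)) {a b : Σ n, X n}
    (h : Homotopic a b) : Homotopic (⟨a.1, F a.1 a.2⟩ : Σ n, Y n) ⟨b.1, F b.1 b.2⟩ := by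
  obtain ⟨k, x, y, rfl, rfl, hxy⟩ := h
  exact ⟨k, _, _, rfl, rfl, hxy.map (hF k)⟩

theorem map_sum_pt {F : ∀ n, X n → Y n}
    (F_dsum : ∀ {n m : ℕ} (x : X n) (y : X m), F (n + m) (S.dsum x y) = T.dsum (F n x) (F m y))
    (F_base : ∀ n, F n (S.base n) = T.base n) (a : Σ n, X n) (d : ℕ) :
    (⟨_, F _ (S.sum a (S.pt d)).2⟩ : Σ n, Y n) = T.sum ⟨a.1, F a.1 a.2⟩ (T.pt d) := by
  simp only [sum, pt, F_dsum, F_base]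

/-- Continuous maps that preserve direct sums and distinguished points, and are invertible up to
homotopy, induce an isomorphism between the monoids of stable homotopy classes. -/
theorem exists_classesEquiv (F : ∀ n, X n → Y n) (G : ∀ n, Y n → X n)
    (hF : ∀ n, Continuous (F n)) (hG : ∀ n, Continuous (G n))
    (F_dsum : ∀ {n m : ℕ} (x : X n) (y : X m), F (n + m) (S.dsum x y) = T.dsum (F n x) (F m y))
    (F_base : ∀ n, F n (S.base n) = T.base n) (hFG : ∀ n y, F n (G n y) = y)
    (hGF : ∀ n x, Joined (G n (F n x)) x) :
    ∃ Φ : S.Classes ≃+ T.Classes, ∀ (n : ℕ) (x : X n), Φ (S.classOf x) = T.classOf (F n x) := by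
  let f : S.Classes → T.Classes :=
    Quotient.map (fun a : Σ n, X n => (⟨a.1, F a.1 a.2⟩ : Σ n, Y n)) (by
      rintro a b ⟨d, d', h⟩
      refine ⟨d, d', ?_⟩
      have h' := h.map hF
      rwa [map_sum_pt F_dsum F_base, map_sum_pt F_dsum F_base] at h')
  have hf : ∀ (n : ℕ) (x : X n), f (S.classOf x) = T.classOf (F n x) := fun _ _ => rfl
  let φ : S.Classes →+ T.Classes :=
    { toFun := f
      map_zero' := (hf 0 (S.base 0)).trans (congrArg T.classOf (F_base 0))
      map_add' := by
        rintro ⟨n, x⟩ ⟨m, y⟩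
        exact congrArg T.classOf (F_dsum x y) }
  have hGF' : ∀ a : Σ n, X n, Homotopic (⟨a.1, G a.1 (F a.1 a.2)⟩ : Σ n, X n) a :=
    fun a => ⟨a.1, _, _, rfl, rfl, hGF a.1 a.2⟩
  refine ⟨AddEquiv.ofBijective φ ⟨?_, ?_⟩, hf⟩
  -- A homotopy between the images of the stabilized elements is pulled back by `G`, and `G ∘ F` is
  -- homotopic to the identity at both ends; `G` need not respect direct sums.
  · rintro ⟨a⟩ ⟨b⟩ h
    obtain ⟨d, d', h⟩ := Quotient.exact h
    refine Quotient.sound ⟨d, d', ?_⟩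
    rw [← map_sum_pt F_dsum F_base, ← map_sum_pt F_dsum F_base] at h
    exact (hGF' _).symm.trans ((h.map hG).trans (hGF' _))
  · rintro ⟨n, y⟩
    exact ⟨S.classOf (G n y), (hf n _).trans (congrArg T.classOf (hFG n y))⟩

end SumSystem

/-! ### Grothendieck groups and conclusion -/

/-- An isomorphism of commutative monoids extends to their Grothendieck groups. -/
theorem exists_grothendieckAddGroup_equiv {M N : Type*} [AddCommMonoid M] [AddCommMonoid N]
    (Φ : M ≃+ N) : ∃ Ψ : Algebra.GrothendieckAddGroup M ≃+ Algebra.GrothendieckAddGroup N,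
      ∀ v, Ψ (Algebra.GrothendieckAddGroup.of v) = Algebra.GrothendieckAddGroup.of (Φ v) := by
  let f := Algebra.GrothendieckAddGroup.lift
    ((Algebra.GrothendieckAddGroup.of (M := N)).comp Φ.toAddMonoidHom)
  let g := Algebra.GrothendieckAddGroup.lift
    ((Algebra.GrothendieckAddGroup.of (M := M)).comp Φ.symm.toAddMonoidHom)
  have hf : ∀ v, f (Algebra.GrothendieckAddGroup.of v) = Algebra.GrothendieckAddGroup.of (Φ v) :=
    fun v => DFunLike.congr_fun (Algebra.GrothendieckAddGroup.lift.symm_apply_apply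
      ((Algebra.GrothendieckAddGroup.of (M := N)).comp Φ.toAddMonoidHom)) v
  have hg : ∀ v, g (Algebra.GrothendieckAddGroup.of v) =
      Algebra.GrothendieckAddGroup.of (Φ.symm v) :=
    fun v => DFunLike.congr_fun (Algebra.GrothendieckAddGroup.lift.symm_apply_apply
      ((Algebra.GrothendieckAddGroup.of (M := M)).comp Φ.symm.toAddMonoidHom)) v
  -- Homomorphisms out of a Grothendieck group are determined on the image of the monoid, so both
  -- composites are checked there.
  refine ⟨AddMonoidHom.toAddEquiv f g ?_ ?_, hf⟩ <;>
    refine Algebra.GrothendieckAddGroup.lift.symm.injective (AddMonoidHom.ext fun v => ?_)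
  · change g (f (Algebra.GrothendieckAddGroup.of v)) = Algebra.GrothendieckAddGroup.of v
    rw [hf, hg, Φ.symm_apply_apply]
  · change f (g (Algebra.GrothendieckAddGroup.of v)) = Algebra.GrothendieckAddGroup.of v
    rw [hg, hf, Φ.apply_symm_apply]

theorem mainTheorem4 {A : Type u} [CStarAlgebra A] [PartialOrder A] [StarOrderedRing A] :
    ∃ (Φ : HermClasses A ≃+ ProjClasses A) (Ψ : OperatorSystemK0 A ≃+ CStarK0 A),
      (∀ (n : ℕ) (x : HermForm A n),
        IsUnit (CFC.abs (toMatAlg x.val)) ∧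
        ∃ hp : IsStarProjection
            ((1 / 2 : ℂ) • (1 - toMatAlg x.val * Ring.inverse (CFC.abs (toMatAlg x.val)))),
          Φ x.toClass = Proj.toClass ⟨_, hp⟩) ∧
      ∀ v : HermClasses A, Ψ (Algebra.GrothendieckAddGroup.of v) =
        Algebra.GrothendieckAddGroup.of (Φ v) := by
  obtain ⟨Φ, hΦ⟩ := SumSystem.exists_classesEquiv (S := hermSystem A) (T := projSystem A)
    (fun _ => HermForm.toProj) (fun _ => Proj.toHermForm) HermForm.continuous_toProj
    Proj.continuous_toHermForm HermForm.toProj_dsum HermForm.toProj_base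
    (fun _ => Proj.toProj_toHermForm) (fun _ => HermForm.joined_toHermForm_toProj)
  obtain ⟨Ψ, hΨ⟩ := exists_grothendieckAddGroup_equiv Φ
  exact ⟨Φ, Ψ, fun n x => ⟨x.isUnit_abs, x.toProj.2, hΦ n x⟩, hΨ⟩
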